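/- Let $K$ be a nonarchimedean local field, let $B$ be a finite-dimensional central division algebra over $K$, and let $\rho$ be the absolute value on $B$ extending that of $K$, that is, $\rho(x)=|N_{B/K}(x)|^{1/[B:K]}$. Every $K$-subalgebra $S$ of $B$ is a division algebra; write $\mathcal{O}_S=\{x\in S:\rho(x)\le 1\}$ for its ring of integers, $\mathfrak{m}_S=\{x\in S:\rho(x)<1\}$ for the maximal ideal of $\mathcal{O}_S$, $\pi_S$ for a generator of $\mathfrak{m}_S$ (a uniformizing parameter), and $\mathbb{S}=\mathcal{O}_S/\mathfrak{m}_S$ for the residue field. For $K$-subalgebras $T\subseteq S$ of $B$, let the residual degree be $f(S/T)=[\mathbb{S}:\mathbb{T}]$ and the ramification index be $e(S/T)=\log_{\rho(\pi_S)}\rho(\pi_T)$. If $L$ is any $K$-subalgebra of $B$ and $C$ is the centralizer of $L$ in $B$, then $$e(L/K)=f(B/C),\qquad f(L/K)=e(B/C).$$ -/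

import Mathlib

/-!
Throughout, `K` is a nonarchimedean local field: a locally compact field with a nontrivial
ultrametric absolute value.  `B` is a finite-dimensional division algebra over `K`, and all
the division algebras `K ⊆ T ⊆ S ⊆ B` are `K`-subalgebras of `B`, with `⊥` for `K` and `⊤` for `B`.
-/

namespace LocalDivisionAlgebra

/-- The absolute value `ρ(x) = |N_{B/K}(x)| ^ (1 / [B : K])` of `B`; it extends that of `K`. -/
noncomputable def absVal (K : Type*) {B : Type*} [NontriviallyNormedField K]
    [DivisionRing B] [Algebra K B] (x : B) : ℝ :=
  ‖Algebra.norm K x‖ ^ (1 / (Module.finrank K B : ℝ))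

section AbsVal

variable {K : Type*} [NontriviallyNormedField K]
variable {B : Type*} [DivisionRing B] [Algebra K B]

theorem absVal_nonneg (x : B) : 0 ≤ absVal K x := Real.rpow_nonneg (norm_nonneg _) _

theorem absVal_one : absVal K (1 : B) = 1 := by simp [absVal]

theorem absVal_mul (x y : B) : absVal K (x * y) = absVal K x * absVal K y := by
  simp [absVal, Real.mul_rpow]

theorem absVal_inv {x : B} (hx : x ≠ 0) : absVal K x * absVal K x⁻¹ = 1 := by
  rw [← absVal_mul, mul_inv_cancel₀ hx, absVal_one]

theorem absVal_pos {x : B} (hx : x ≠ 0) : 0 < absVal K x := by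
  refine (absVal_nonneg x).lt_of_ne fun h => ?_
  have := absVal_inv (K := K) hx
  simp [← h] at this

/-- The norm of an element that lies in the image of a field extension of `K`. -/
theorem norm_of_field {E : Type*} [Field E] [Algebra K E] [FiniteDimensional K E]
    (φ : E →ₐ[K] B) (e : E) :
    ∃ m : ℕ, Module.finrank K B = Module.finrank K E * m ∧
      Algebra.norm K (φ e) = Algebra.norm K e ^ m := by
  let _ : Module E B := Module.compHom B φ.toRingHom
  have hsm : ∀ (a : E) (b : B), a • b = φ a * b := fun _ _ => rfl
  have : IsScalarTower K E B := ⟨fun k a b => by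
    rw [hsm, hsm, map_smul, smul_mul_assoc]⟩
  refine ⟨Module.finrank E B, (Module.finrank_mul_finrank K E B).symm, ?_⟩
  have h := LinearMap.det_restrictScalars (R := K) (S := E) (A := B)
    (f := e • (LinearMap.id : B →ₗ[E] B))
  rw [LinearMap.det_smul, LinearMap.det_id, mul_one, map_pow] at h
  rw [← h, Algebra.norm_apply]
  rfl

variable [FiniteDimensional K B]

theorem absVal_pow_finrank (x : B) :
    absVal K x ^ Module.finrank K B = ‖Algebra.norm K x‖ := by
  have h : (Module.finrank K B : ℝ) ≠ 0 := by
    exact_mod_cast (Module.finrank_pos (R := K) (M := B)).ne'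
  rw [absVal, ← Real.rpow_natCast, ← Real.rpow_mul (norm_nonneg _), one_div_mul_cancel h,
    Real.rpow_one]

theorem absVal_algebraMap (a : K) : absVal K (algebraMap K B a) = ‖a‖ := by
  have h : (Module.finrank K B : ℝ) ≠ 0 := by
    exact_mod_cast (Module.finrank_pos (R := K) (M := B)).ne'
  rw [absVal, Algebra.norm_algebraMap, norm_pow, ← Real.rpow_natCast,
    ← Real.rpow_mul (norm_nonneg _), mul_one_div_cancel h, Real.rpow_one]

theorem absVal_zero : absVal K (0 : B) = 0 := by
  simpa using absVal_algebraMap (B := B) (0 : K)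

theorem absVal_neg (x : B) : absVal K (-x) = absVal K x := by
  have h := absVal_mul (K := K) (-1) x
  have h1 : absVal K (-1 : B) = 1 := by simpa using absVal_algebraMap (B := B) (-1 : K)
  simpa [h1] using h

variable [IsUltrametricDist K] [LocallyCompactSpace K]

theorem absVal_of_generator {E : Type*} [Field E] [Algebra K E] [FiniteDimensional K E]
    (φ : E →ₐ[K] B) (e : E) : absVal K (φ e) = spectralNorm K E e := by
  have : ProperSpace K := ProperSpace.of_locallyCompactSpace K
  let F := IntermediateField.adjoin K {e}
  have hint : IsIntegral K e := Algebra.IsIntegral.isIntegral e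
  obtain ⟨m, hm, hN⟩ := norm_of_field (φ.comp F.val) (IntermediateField.AdjoinSimple.gen K e)
  have hφ : (φ.comp F.val) (IntermediateField.AdjoinSimple.gen K e) = φ e := rfl
  rw [hφ] at hN
  have hfr : Module.finrank K F = (minpoly K e).natDegree :=
    IntermediateField.adjoin.finrank hint
  have hgen := Algebra.PowerBasis.norm_gen_eq_coeff_zero_minpoly
    (IntermediateField.adjoin.powerBasis hint)
  rw [IntermediateField.adjoin.powerBasis_gen, IntermediateField.minpoly_gen] at hgen
  have hpos := Module.finrank_pos (R := K) (M := B)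
  have hm0 : (m : ℝ) ≠ 0 := by
    rintro h
    have : m = 0 := by exact_mod_cast h
    simp [this] at hm
    omega
  rw [absVal, hN, hgen, spectralNorm.spectralNorm_eq_norm_coeff_zero_rpow, hm, hfr]
  simp only [norm_pow, norm_mul, norm_neg, norm_one, one_pow, one_mul]
  rw [← Real.rpow_natCast, ← Real.rpow_mul (norm_nonneg _)]
  congr 1
  push_cast
  by_cases h : ((minpoly K e).natDegree : ℝ) = 0
  · simp [h]
  · field_simp

theorem absVal_one_add_le (x : B) : absVal K (1 + x) ≤ max 1 (absVal K x) := by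
  have hint : IsIntegral K x := Algebra.IsIntegral.isIntegral x
  have : Fact (Irreducible (minpoly K x)) := ⟨minpoly.irreducible hint⟩
  let E := AdjoinRoot (minpoly K x)
  have : FiniteDimensional K E := (AdjoinRoot.powerBasis (minpoly.ne_zero hint)).finite
  obtain ⟨φ, hφ⟩ : ∃ φ : E →ₐ[K] B, φ (AdjoinRoot.root (minpoly K x)) = x := by
    refine ⟨(Ideal.Quotient.liftₐ (Ideal.span {minpoly K x}) (Polynomial.aeval x) ?_), ?_⟩
    · intro a ha
      obtain ⟨b, rfl⟩ := Ideal.mem_span_singleton.1 ha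
      simp
    · exact Polynomial.aeval_X (R := K) x
  have h1 : (1 : B) + x = φ (1 + AdjoinRoot.root (minpoly K x)) := by simp [hφ]
  have hx := absVal_of_generator φ (AdjoinRoot.root (minpoly K x))
  rw [hφ] at hx
  rw [h1, absVal_of_generator, hx]
  refine (isNonarchimedean_spectralNorm (K := K) (L := E) _ _).trans ?_
  rw [spectralNorm_one]

theorem absVal_add_le (x y : B) : absVal K (x + y) ≤ max (absVal K x) (absVal K y) := by
  by_cases hx : x = 0
  · simp [hx]
  have h : x + y = x * (1 + x⁻¹ * y) := by
    rw [mul_add, mul_one, mul_inv_cancel_left₀ hx]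
  have h2 : y = x * (x⁻¹ * y) := by rw [mul_inv_cancel_left₀ hx]
  have h3 : absVal K y = absVal K x * absVal K (x⁻¹ * y) := by rw [← absVal_mul, ← h2]
  rw [h, absVal_mul, h3]
  refine (mul_le_mul_of_nonneg_left (absVal_one_add_le (x⁻¹ * y)) (absVal_nonneg x)).trans ?_
  rw [mul_max_of_nonneg _ _ (absVal_nonneg x), mul_one]

end AbsVal

section Residue

variable {K : Type*} [NontriviallyNormedField K] [IsUltrametricDist K] [LocallyCompactSpace K]
variable {B : Type*} [DivisionRing B] [Algebra K B] [FiniteDimensional K B]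

/-- The ring of integers `{x ∈ S | ρ(x) ≤ 1}` of `S`. -/
noncomputable def integers (S : Subalgebra K B) : Subring B where
  carrier := {x | x ∈ S ∧ absVal K x ≤ 1}
  zero_mem' := ⟨S.zero_mem, by rw [absVal_zero]; exact zero_le_one⟩
  one_mem' := ⟨S.one_mem, absVal_one.le⟩
  add_mem' := fun ha hb => ⟨S.add_mem ha.1 hb.1, (absVal_add_le _ _).trans (max_le ha.2 hb.2)⟩
  neg_mem' := fun ha => ⟨S.neg_mem ha.1, by rw [absVal_neg]; exact ha.2⟩
  mul_mem' := fun ha hb => ⟨S.mul_mem ha.1 hb.1, by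
    rw [absVal_mul]; exact mul_le_one₀ ha.2 (absVal_nonneg _) hb.2⟩

/-- The maximal ideal `{x ∈ S | ρ(x) < 1}` of the ring of integers of `S`. -/
noncomputable def maxIdeal (S : Subalgebra K B) : Ideal (integers S) where
  carrier := {x | absVal K (x : B) < 1}
  zero_mem' := by simp [absVal_zero]
  add_mem' := fun ha hb => (absVal_add_le _ _).trans_lt (max_lt ha hb)
  smul_mem' := fun c x hx => by
    simp only [smul_eq_mul, Set.mem_ofPred_eq, Subring.coe_mul, absVal_mul] at hx ⊢
    exact mul_lt_one_of_nonneg_of_lt_one_right c.2.2 (absVal_nonneg _) hx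

instance maxIdeal_isTwoSided (S : Subalgebra K B) : (maxIdeal S).IsTwoSided where
  mul_mem_of_left := fun {a} b ha => by
    change absVal K ((a * b : integers S) : B) < 1
    rw [Subring.coe_mul, absVal_mul]
    exact mul_lt_one_of_nonneg_of_lt_one_left (absVal_nonneg _) ha b.2.2

/-- The residue field of `S`. -/
abbrev ResidueField (S : Subalgebra K B) : Type _ := integers S ⧸ maxIdeal S

theorem integers_mono {T S : Subalgebra K B} (h : T ≤ S) : integers T ≤ integers S :=
  fun _ hx => ⟨h hx.1, hx.2⟩

/-- The inclusion of the residue field of `T` in that of `S`, for `T ⊆ S`. -/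
noncomputable def residueMap {T S : Subalgebra K B} (h : T ≤ S) :
    ResidueField T →+* ResidueField S :=
  Ideal.Quotient.lift (maxIdeal T)
    ((Ideal.Quotient.mk (maxIdeal S)).comp (Subring.inclusion (integers_mono h)))
    fun a ha => by
      rw [RingHom.comp_apply, Ideal.Quotient.eq_zero_iff_mem]
      exact ha

/-- The residual degree `f(S/T)`: the degree of the extension of residue fields. -/
noncomputable def residualDegree {T S : Subalgebra K B} (h : T ≤ S) : ℕ :=
  letI : Module (ResidueField T) (ResidueField S) := Module.compHom _ (residueMap h)
  Module.finrank (ResidueField T) (ResidueField S)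

/-- `π` is a uniformizing parameter of `S`: it generates the maximal ideal. -/
def IsUniformizer (S : Subalgebra K B) (π : integers S) : Prop :=
  maxIdeal S = Ideal.span {π}


theorem mem_maxIdeal {S : Subalgebra K B} {x : integers S} :
    x ∈ maxIdeal S ↔ absVal K (x : B) < 1 := Iff.rfl

variable (K) in
/-- The absolute value of `K` is discrete. -/
theorem exists_norm_eq_zpow :
    ∃ p : ℝ, 0 < p ∧ p < 1 ∧ ∀ a : K, a ≠ 0 → ∃ j : ℤ, ‖a‖ = p ^ j := by
  have : ProperSpace K := ProperSpace.of_locallyCompactSpace K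
  have hc : IsCompact (Metric.ball (0 : K) 1) :=
    (isCompact_closedBall (0 : K) 1).of_isClosed_subset (IsUltrametricDist.isClosed_ball _ _)
      Metric.ball_subset_closedBall
  obtain ⟨a₀, ha₀, hmax⟩ := hc.exists_isMaxOn ⟨0, by simp⟩ (continuous_norm (E := K)).continuousOn
  obtain ⟨b, hb0, hb1⟩ := NormedField.exists_norm_lt_one K
  have hmax' : ∀ a : K, ‖a‖ < 1 → ‖a‖ ≤ ‖a₀‖ := fun a ha => hmax (by simpa using ha)
  have h0 : 0 < ‖a₀‖ := hb0.trans_le (hmax' b hb1)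
  have h1 : ‖a₀‖ < 1 := by simpa using ha₀
  refine ⟨‖a₀‖, h0, h1, fun a ha => ?_⟩
  obtain ⟨n, hn1, hn2⟩ := exists_mem_Ico_zpow (norm_pos_iff.2 ha) ((one_lt_inv₀ h0).2 h1)
  refine ⟨-n, ?_⟩
  rw [inv_zpow'] at hn1 hn2
  refine le_antisymm ?_ hn1
  have h2 : ‖a * a₀ ^ (n + 1)‖ < 1 := by
    rw [norm_mul, norm_zpow]
    calc ‖a‖ * ‖a₀‖ ^ (n + 1) < ‖a₀‖ ^ (-(n + 1)) * ‖a₀‖ ^ (n + 1) := by gcongr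
      _ = 1 := by rw [← zpow_add₀ h0.ne']; simp
  have h3 := hmax' _ h2
  rw [norm_mul, norm_zpow, zpow_add₀ h0.ne', zpow_one, ← mul_assoc] at h3
  have h4 : ‖a‖ * ‖a₀‖ ^ n ≤ 1 := le_of_mul_le_mul_right (by simpa using h3) h0
  rw [zpow_neg]
  rwa [← one_div, le_div_iff₀ (zpow_pos h0 n)]

theorem exists_isUniformizer (S : Subalgebra K B) : ∃ π : integers S, IsUniformizer S π := by
  classical
  obtain ⟨p, hp0, hp1, hp⟩ := exists_norm_eq_zpow K
  have hd := (Module.finrank_pos (R := K) (M := B)).ne'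
  have hval : ∀ x : B, x ≠ 0 → absVal K x < 1 →
      ∃ j : ℕ, absVal K x ^ Module.finrank K B = p ^ j := by
    intro x hx hx1
    have hne : Algebra.norm K x ≠ 0 := by
      rw [← norm_pos_iff, ← absVal_pow_finrank]
      exact pow_pos (absVal_pos hx) _
    obtain ⟨j, hj⟩ := hp _ hne
    rw [← absVal_pow_finrank] at hj
    have hlt : p ^ j < 1 := hj ▸ pow_lt_one₀ (absVal_nonneg x) hx1 hd
    have hj0 : 0 ≤ j := by
      by_contra! hneg
      exact absurd hlt (not_lt.2 (one_le_zpow_of_nonpos₀ hp0 hp1.le hneg.le))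
    lift j to ℕ using hj0
    exact ⟨j, by simpa using hj⟩
  have hex : ∃ j : ℕ, ∃ x ∈ S, x ≠ 0 ∧ absVal K x < 1 ∧
      absVal K x ^ Module.finrank K B = p ^ j := by
    obtain ⟨b, hb0, hb1⟩ := NormedField.exists_norm_lt_one K
    have hb : algebraMap K B b ≠ 0 := by simpa using norm_pos_iff.1 hb0
    have hb' : absVal K (algebraMap K B b) < 1 := by rwa [absVal_algebraMap]
    obtain ⟨j, hj⟩ := hval _ hb hb'
    exact ⟨j, _, S.algebraMap_mem b, hb, hb', hj⟩
  obtain ⟨π, hπS, hπ0, hπ1, hπj⟩ := Nat.find_spec hex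
  refine ⟨⟨π, hπS, hπ1.le⟩, ?_⟩
  have hinv : π⁻¹ ∈ S := by
    have hinj : Function.Injective (LinearMap.mulLeft K (⟨π, hπS⟩ : S)) := fun a b hab =>
      Subtype.ext (mul_left_cancel₀ hπ0 (congrArg Subtype.val hab))
    obtain ⟨y, hy⟩ := LinearMap.injective_iff_surjective.1 hinj 1
    have hy' : π * (y : B) = 1 := congrArg Subtype.val hy
    rw [inv_eq_of_mul_eq_one_right hy']
    exact y.2
  refine le_antisymm (fun x hx => ?_) ?_
  · rw [Ideal.mem_span_singleton']
    have hxle : absVal K (x : B) ≤ absVal K π := by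
      by_cases hx0 : (x : B) = 0
      · rw [hx0, absVal_zero]
        exact absVal_nonneg _
      obtain ⟨j, hj⟩ := hval x hx0 hx
      have hmin : Nat.find hex ≤ j := Nat.find_min' hex ⟨x, x.2.1, hx0, hx, hj⟩
      refine le_of_pow_le_pow_left₀ hd (absVal_nonneg _) ?_
      rw [hj, hπj]
      exact pow_le_pow_of_le_one hp0.le hp1.le hmin
    refine ⟨⟨x * π⁻¹, S.mul_mem x.2.1 hinv, ?_⟩, Subtype.ext ?_⟩
    · rw [absVal_mul, ← absVal_inv (K := K) hπ0]
      exact mul_le_mul_of_nonneg_right hxle (absVal_nonneg _)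
    · exact inv_mul_cancel_right₀ hπ0 _
  · rw [Ideal.span_le, Set.singleton_subset_iff]
    exact hπ1

/-- A uniformizing parameter `π_S` of `S`; its absolute value does not depend on the choice. -/
noncomputable def uniformizer (S : Subalgebra K B) : integers S :=
  (exists_isUniformizer S).choose

/-- The ramification index `e(S/T) = log_{ρ(π_S)} ρ(π_T)`, for `T ⊆ S`. -/
noncomputable def ramificationIndex {T S : Subalgebra K B} (_h : T ≤ S) : ℝ :=
  Real.logb (absVal K (uniformizer S : B)) (absVal K (uniformizer T : B))

end Residue

end LocalDivisionAlgebra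

/-! Everything rests on one uniformizer `y` of `B`. Conjugation by `y` induces an automorphism σ of
the finite residue field of `B`. By `exists_uniformizer_conj_fixed`, `y` can be chosen so that the
fixed field of σ is the residue field of `K` and `y ^ f(B/K)` lies in `K`. To construct it, lift a
generator of the residual multiplicative group to a root of unity ζ, then average a uniformizer so
that it normalizes the group generated by ζ. An element commuting with ζ and `y` commutes with a
dense subset of `B`, so it is central and lies in `K`.

Two inequalities follow. Comparing values, `y ^ f(B/K) ∈ K` gives e(B/K) ≤ f(B/K)
(`ramification_le_residualDegree`). If `L` and `C` commute and d = e(B/C), then `y ^ d` is a unit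
times a uniformizer of `C`. The unit acts trivially on the commutative residue field and the
uniformizer centralizes `L`, so σ^d fixes the residue field of `L`. Hence f(L/K) ≤ e(B/C)
(`residualDegree_le_of_commute`), and taking `L = B`, `C = K` gives f(B/K) = e(B/K) = n.

The conclusion is a count. By `mul_residualDegree_le_finrank`,
`finrank_le_finrank_mul_finrank_centralizer` and `finrank_le_mul_residualDegree`, n² ≤ [B:K] ≤
[L:K][C:K] ≤ e(L/K) f(L/K) e(C/K) f(C/K). Since n = e(B/L) e(L/K) = e(B/C) e(C/K), this gives e(B/L)
e(B/C) ≤ f(L/K) f(C/K). With f(L/K) ≤ e(B/C) and f(C/K) ≤ e(B/L), both bounds must be equalities.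
Multiplicativity of f in towers then yields e(L/K) = f(B/C). -/

namespace LocalDivisionAlgebra

/-! ### Value groups, residue fields and compactness. -/

section Basic

variable {K : Type*} [NontriviallyNormedField K]
variable {B : Type*} [DivisionRing B] [Algebra K B]

theorem absVal_conj {y : B} (hy : y ≠ 0) (x : B) : absVal K (y * x * y⁻¹) = absVal K x := by
  rw [absVal_mul, absVal_mul, mul_right_comm, absVal_inv hy, one_mul]

variable [FiniteDimensional K B]

theorem inv_mem_subalgebra (S : Subalgebra K B) {x : B} (hx : x ∈ S) : x⁻¹ ∈ S := by
  by_cases hx0 : x = 0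
  · simp [hx0]
  have hinj : Function.Injective (LinearMap.mulLeft K (⟨x, hx⟩ : S)) := fun a b hab =>
    Subtype.ext (mul_left_cancel₀ hx0 (congrArg Subtype.val hab))
  obtain ⟨y, hy⟩ := LinearMap.injective_iff_surjective.1 hinj 1
  have hy' : x * (y : B) = 1 := congrArg Subtype.val hy
  rw [inv_eq_of_mul_eq_one_right hy']
  exact y.2

theorem zpow_mem_subalgebra (S : Subalgebra K B) {x : B} (hx : x ∈ S) (n : ℤ) : x ^ n ∈ S := by
  cases n with
  | ofNat n => simpa using S.pow_mem hx n
  | negSucc n => simpa using inv_mem_subalgebra S (S.pow_mem hx (n + 1))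

variable (K B) in
/-- `ρ` as a monoid homomorphism with zero. -/
noncomputable def absValHom : B →*₀ ℝ where
  toFun := absVal K
  map_zero' := absVal_zero
  map_one' := absVal_one
  map_mul' := absVal_mul

theorem absVal_inv_eq (x : B) : absVal K x⁻¹ = (absVal K x)⁻¹ := map_inv₀ (absValHom K B) x

theorem absVal_pow (x : B) (n : ℕ) : absVal K (x ^ n) = absVal K x ^ n :=
  map_pow (absValHom K B) x n

theorem absVal_zpow (x : B) (n : ℤ) : absVal K (x ^ n) = absVal K x ^ n :=
  map_zpow₀ (absValHom K B) x n

theorem absVal_eq_zero_iff {x : B} : absVal K x = 0 ↔ x = 0 :=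
  map_eq_zero (absValHom K B)

variable [IsUltrametricDist K] [LocallyCompactSpace K]

theorem absVal_sub_le (x y : B) : absVal K (x - y) ≤ max (absVal K x) (absVal K y) := by
  rw [sub_eq_add_neg, ← absVal_neg y]
  exact absVal_add_le _ _

theorem absVal_eq_of_sub_lt {x y : B} (h : absVal K (x - y) < absVal K y) :
    absVal K x = absVal K y := by
  have h1 := absVal_add_le (K := K) (x - y) y
  have h2 := absVal_sub_le (K := K) x (x - y)
  rw [sub_add_cancel, max_eq_right h.le] at h1
  rw [sub_sub_cancel] at h2
  rcases le_max_iff.1 h2 with h3 | h3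
  · exact le_antisymm h1 h3
  · exact absurd h (not_lt.2 h3)

theorem absVal_sum_lt {ι : Type*} (s : Finset ι) (f : ι → B) {c : ℝ} (hc : 0 < c)
    (h : ∀ i ∈ s, absVal K (f i) < c) : absVal K (∑ i ∈ s, f i) < c := by
  induction s using Finset.cons_induction with
  | empty => simpa [absVal_zero] using hc
  | cons a s ha ih =>
    rw [Finset.sum_cons]
    exact (absVal_add_le _ _).trans_lt (max_lt (h a (by simp))
      (ih fun i hi => h i (Finset.mem_cons_of_mem hi)))

/-- The absolute value of a uniformizing parameter of `S`. -/
noncomputable abbrev unifVal (S : Subalgebra K B) : ℝ := absVal K (uniformizer S : B)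

theorem isUniformizer_uniformizer (S : Subalgebra K B) : IsUniformizer S (uniformizer S) :=
  (exists_isUniformizer S).choose_spec

theorem absVal_le_unifVal {S : Subalgebra K B} {x : B} (hxS : x ∈ S) (hx : absVal K x < 1) :
    absVal K x ≤ unifVal S := by
  have h : (⟨x, hxS, hx.le⟩ : integers S) ∈ maxIdeal S := hx
  rw [isUniformizer_uniformizer S, Ideal.mem_span_singleton'] at h
  obtain ⟨a, ha⟩ := h
  have ha' : (a : B) * (uniformizer S : B) = x := congrArg Subtype.val ha
  rw [← ha', absVal_mul]
  exact mul_le_of_le_one_left (absVal_nonneg _) a.2.2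

theorem unifVal_lt_one (S : Subalgebra K B) : unifVal S < 1 := by
  have h : uniformizer S ∈ maxIdeal S := by
    rw [isUniformizer_uniformizer S]
    exact Ideal.mem_span_singleton_self _
  exact h

theorem unifVal_pos (S : Subalgebra K B) : 0 < unifVal S := by
  obtain ⟨b, hb0, hb1⟩ := NormedField.exists_norm_lt_one K
  rw [← absVal_algebraMap (B := B)] at hb0 hb1
  exact hb0.trans_le (absVal_le_unifVal (S.algebraMap_mem b) hb1)

theorem uniformizer_ne_zero (S : Subalgebra K B) : (uniformizer S : B) ≠ 0 :=
  fun h => (unifVal_pos S).ne' (absVal_eq_zero_iff.2 h)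

/-- No value on `S` lies strictly between ρ(π) and 1. Choose `n` with ρ(xπⁿ) ≥ 1 > ρ(xπⁿ⁺¹); the
latter value is then at most ρ(π), so ρ(xπⁿ) = 1. -/
theorem exists_absVal_eq_zpow {S : Subalgebra K B} {x : B} (hxS : x ∈ S) (hx : x ≠ 0) :
    ∃ n : ℤ, absVal K x = unifVal S ^ n := by
  have h0 := unifVal_pos S
  have h1 := unifVal_lt_one S
  obtain ⟨n, hn1, hn2⟩ := exists_mem_Ico_zpow (absVal_pos (K := K) hx) ((one_lt_inv₀ h0).2 h1)
  refine ⟨-n, ?_⟩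
  rw [inv_zpow'] at hn1 hn2
  refine le_antisymm ?_ hn1
  have h2 : absVal K (x * (uniformizer S : B) ^ (n + 1)) < 1 := by
    rw [absVal_mul, absVal_zpow]
    calc absVal K x * unifVal S ^ (n + 1) < unifVal S ^ (-(n + 1)) * unifVal S ^ (n + 1) := by
          gcongr
      _ = 1 := by rw [← zpow_add₀ h0.ne']; simp
  have h3 := absVal_le_unifVal
    (S.mul_mem hxS (zpow_mem_subalgebra S (uniformizer S).2.1 (n + 1))) h2
  rw [absVal_mul, absVal_zpow, zpow_add₀ h0.ne', zpow_one, ← mul_assoc] at h3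
  have h4 : absVal K x * unifVal S ^ n ≤ 1 := le_of_mul_le_mul_right (by simpa using h3) h0
  rw [zpow_neg]
  rwa [← one_div, le_div_iff₀ (zpow_pos h0 n)]

/-- The uniformizer of `T` has value a power of that of `S`, so the real logarithm is a natural
number. The equation between values is the form used in all later counting. -/
theorem exists_ramificationIndex_eq {T S : Subalgebra K B} (h : T ≤ S) :
    ∃ e : ℕ, 0 < e ∧ unifVal T = unifVal S ^ e ∧ ramificationIndex h = e := by
  obtain ⟨n, hn⟩ := exists_absVal_eq_zpow (h (uniformizer T).2.1) (uniformizer_ne_zero T)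
  have h0 := unifVal_pos S
  have h1 := unifVal_lt_one S
  have hn0 : 0 < n := by
    by_contra! hneg
    exact absurd (hn ▸ unifVal_lt_one T) (not_lt.2 (one_le_zpow_of_nonpos₀ h0 h1.le hneg))
  lift n to ℕ using hn0.le
  rw [zpow_natCast] at hn
  refine ⟨n, by exact_mod_cast hn0, hn, ?_⟩
  rw [ramificationIndex, hn, Real.logb_pow, Real.logb,
    div_self (Real.log_ne_zero_of_pos_of_ne_one h0 h1.ne), mul_one]

theorem residue_eq_iff {S : Subalgebra K B} {x y : integers S} :
    Ideal.Quotient.mk (maxIdeal S) x = Ideal.Quotient.mk (maxIdeal S) y ↔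
      absVal K ((x : B) - y) < 1 := by
  rw [Ideal.Quotient.eq]
  rfl

theorem residue_eq_zero_iff {S : Subalgebra K B} {x : integers S} :
    Ideal.Quotient.mk (maxIdeal S) x = 0 ↔ absVal K (x : B) < 1 :=
  Ideal.Quotient.eq_zero_iff_mem

theorem residueMap_mk {T S : Subalgebra K B} (h : T ≤ S) (x : integers T) :
    residueMap h (Ideal.Quotient.mk _ x) =
      Ideal.Quotient.mk _ (Subring.inclusion (integers_mono h) x) := rfl

theorem residueMap_injective {T S : Subalgebra K B} (h : T ≤ S) :
    Function.Injective (residueMap h) := by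
  rw [injective_iff_map_eq_zero]
  intro a ha
  obtain ⟨x, rfl⟩ := Ideal.Quotient.mk_surjective a
  rw [residueMap_mk, residue_eq_zero_iff] at ha
  exact residue_eq_zero_iff.2 ha

instance residueField_isDomain (S : Subalgebra K B) : IsDomain (ResidueField S) := by
  have : Nontrivial (ResidueField S) := ⟨⟨1, 0, fun h => by
    have h1 : Ideal.Quotient.mk (maxIdeal S) 1 = 0 := h
    rw [residue_eq_zero_iff, Subring.coe_one, absVal_one] at h1
    exact lt_irrefl _ h1⟩⟩
  have : NoZeroDivisors (ResidueField S) := ⟨fun {a b} hab => by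
    obtain ⟨x, rfl⟩ := Ideal.Quotient.mk_surjective a
    obtain ⟨y, rfl⟩ := Ideal.Quotient.mk_surjective b
    rw [← map_mul, residue_eq_zero_iff, Subring.coe_mul, absVal_mul] at hab
    rw [residue_eq_zero_iff, residue_eq_zero_iff]
    by_contra! hcon
    rw [le_antisymm x.2.2 hcon.1, le_antisymm y.2.2 hcon.2, one_mul] at hab
    exact lt_irrefl _ hab⟩
  exact NoZeroDivisors.to_isDomain _

/-- `B` as a normed group with the norm `ρ`. -/
noncomputable abbrev normedAddCommGroup (K B : Type*) [NontriviallyNormedField K]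
    [IsUltrametricDist K] [LocallyCompactSpace K] [DivisionRing B] [Algebra K B]
    [FiniteDimensional K B] : NormedAddCommGroup B :=
  AddGroupNorm.toNormedAddCommGroup
    { toFun := absVal K
      map_zero' := absVal_zero
      add_le' := fun x y => (absVal_add_le x y).trans
        (max_le_add_of_nonneg (absVal_nonneg x) (absVal_nonneg y))
      neg' := absVal_neg
      eq_zero_of_map_eq_zero' := fun _ => absVal_eq_zero_iff.1 }

/-- `B` as a normed space with the norm `ρ`. -/
noncomputable abbrev normedSpace (K B : Type*) [NontriviallyNormedField K]
    [IsUltrametricDist K] [LocallyCompactSpace K] [DivisionRing B] [Algebra K B]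
    [FiniteDimensional K B] :
    @NormedSpace K B _ (normedAddCommGroup K B).toSeminormedAddCommGroup :=
  letI := normedAddCommGroup K B
  { norm_smul_le := fun a b => by
      change absVal K (a • b) ≤ ‖a‖ * absVal K b
      rw [Algebra.smul_def, absVal_mul, absVal_algebraMap] }

/-- With norm ρ, `B` is a finite-dimensional normed space over a locally compact field, so its
closed unit ball is compact. -/
theorem exists_subseq_tendsto (u : ℕ → B) (hu : ∀ n, absVal K (u n) ≤ 1) :
    ∃ x : B, absVal K x ≤ 1 ∧ ∃ φ : ℕ → ℕ, StrictMono φ ∧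
      Filter.Tendsto (fun n => absVal K (u (φ n) - x)) Filter.atTop (nhds 0) := by
  let _ := normedAddCommGroup K B
  let _ := normedSpace K B
  have : ProperSpace B := FiniteDimensional.proper K B
  have hmem : ∀ n, u n ∈ Metric.closedBall (0 : B) 1 := fun n => by
    rw [mem_closedBall_zero_iff]
    exact hu n
  obtain ⟨x, hx, φ, hφ, hlim⟩ := (isCompact_closedBall (0 : B) 1).tendsto_subseq hmem
  rw [mem_closedBall_zero_iff] at hx
  exact ⟨x, hx, φ, hφ, tendsto_iff_norm_sub_tendsto_zero.1 hlim⟩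

/-- A subspace that approximates all elements of `S` contains `S`. -/
theorem le_of_exists_approx (S : Subalgebra K B) (M : Submodule K B)
    (hM : M ≤ Subalgebra.toSubmodule S)
    (h : ∀ x ∈ S, x ≠ 0 → ∃ y ∈ M, absVal K (x - y) < absVal K x) :
    Subalgebra.toSubmodule S ≤ M := by
  let _ := normedAddCommGroup K B
  let _ := normedSpace K B
  have : ProperSpace K := ProperSpace.of_locallyCompactSpace K
  have : ProperSpace B := FiniteDimensional.proper K B
  have hcl : IsClosed (M : Set B) := M.closed_of_finiteDimensional
  intro x hx
  -- A nearest point `y` of `M` exists because `M` is closed in a proper space. If `x ≠ y`,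
  -- approximating `x - y` within `M` would give a nearer point.
  obtain ⟨y, hy, hxy⟩ := hcl.exists_infDist_eq_dist ⟨0, M.zero_mem⟩ x
  by_contra hxM
  have hne : x - y ≠ 0 := fun h0 => hxM (by rwa [sub_eq_zero.1 h0])
  obtain ⟨z, hz, hlt⟩ := h (x - y) (S.sub_mem hx (hM hy)) hne
  have h1 := Metric.infDist_le_dist_of_mem (x := x) (M.add_mem hy hz)
  rw [hxy, dist_eq_norm, dist_eq_norm, ← sub_sub] at h1
  exact absurd hlt (not_lt.2 h1)

/-- Representatives of infinitely many classes would have a convergent subsequence, two terms of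
which are congruent. Being finite domains, the residue rings are commutative fields by Wedderburn's
theorem. -/
instance residueField_finite (S : Subalgebra K B) : Finite (ResidueField S) := by
  by_contra hfin
  have : Infinite (ResidueField S) := not_finite_iff_infinite.1 hfin
  let g := Infinite.natEmbedding (ResidueField S)
  choose u hu using fun n => Ideal.Quotient.mk_surjective (g n)
  obtain ⟨x, -, φ, hφ, hlim⟩ := exists_subseq_tendsto (K := K) (fun n => (u n : B))
    (fun n => (u n).2.2)
  obtain ⟨N, hN⟩ := Filter.eventually_atTop.1 (hlim.eventually_lt_const one_pos)
  have h1 : absVal K ((u (φ N) : B) - u (φ (N + 1))) < 1 := by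
    have h2 := absVal_sub_le (K := K) ((u (φ N) : B) - x) (u (φ (N + 1)) - x)
    rw [sub_sub_sub_cancel_right] at h2
    exact h2.trans_lt (max_lt (hN N le_rfl) (hN (N + 1) (Nat.le_succ N)))
  rw [← residue_eq_iff, hu, hu] at h1
  exact absurd (hφ.injective (g.injective h1)) (Nat.lt_succ_self N).ne

end Basic

/-! ### The dimension bound for centralizers. -/

section Centralizer

variable {K : Type*} [Field K] {B : Type*} [DivisionRing B] [Algebra K B]

/-- If `b` is linearly independent over the centralizer of `L`, a relation
`∑ xⱼ l bⱼ = 0` that holds for all `l ∈ L` is trivial. -/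
theorem eq_zero_of_forall_sum_mul_mul_eq_zero (L : Subalgebra K B) {ι : Type*} [Fintype ι]
    (b : ι → B) (hb : LinearIndependent (Subalgebra.centralizer K (L : Set B)) b) (x : ι → B)
    (hx : ∀ l ∈ L, ∑ j, x j * l * b j = 0) : x = 0 := by
  classical
  induction hn : (Finset.univ.filter fun j => x j ≠ 0).card using Nat.strong_induction_on
    generalizing x with
  | _ n ih =>
  by_contra hx0
  obtain ⟨j₀, hj₀⟩ := Function.ne_iff.1 hx0
  rw [Pi.zero_apply] at hj₀
  -- Induction on the size of the support. Once one coefficient is 1, the commutators with `l ∈ L`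
  -- form a relation of smaller support, hence vanish. The coefficients thus lie in the centralizer,
  -- and independence applies to the relation at `l = 1`.
  let y : ι → B := fun j => (x j₀)⁻¹ * x j
  have hy1 : y j₀ = 1 := inv_mul_cancel₀ hj₀
  have hy : ∀ l ∈ L, ∑ j, y j * l * b j = 0 := fun l hl => by
    have := congrArg ((x j₀)⁻¹ * ·) (hx l hl)
    simpa [Finset.mul_sum, y, mul_assoc] using this
  have hcomm : ∀ l ∈ L, (fun j => y j * l - l * y j) = 0 := by
    intro l hl
    refine ih _ ?_ _ ?_ rfl
    · rw [← hn]
      refine Finset.card_lt_card ?_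
      rw [Finset.ssubset_iff_of_subset]
      · exact ⟨j₀, by simpa using hj₀, by simp [hy1]⟩
      · intro j
        simp only [Finset.mem_filter, Finset.mem_univ, true_and]
        intro hj hxj
        exact hj (by simp [y, hxj])
    · intro l' hl'
      -- The commutator relation at `l'` is the relation at `l * l'` minus `l` times the relation at
      -- `l'`.
      have h1 := hy _ (L.mul_mem hl hl')
      have h2 := congrArg (l * ·) (hy _ hl')
      simp only [Finset.mul_sum, mul_zero] at h2
      rw [← sub_eq_zero.2 (h1.trans h2.symm), ← Finset.sum_sub_distrib]
      refine Finset.sum_congr rfl fun j _ => ?_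
      simp only [sub_mul, mul_assoc]
  have hmem : ∀ j, y j ∈ Subalgebra.centralizer K (L : Set B) := fun j => by
    rw [Subalgebra.mem_centralizer_iff]
    intro l hl
    exact (sub_eq_zero.1 (congrFun (hcomm l hl) j)).symm
  have h0 := Fintype.linearIndependent_iff.1 hb (fun j => ⟨y j, hmem j⟩) (by
    simpa [Subalgebra.smul_def] using hy 1 L.one_mem) j₀
  have h1 : y j₀ = 0 := congrArg Subtype.val h0
  exact one_ne_zero (hy1.symm.trans h1)

/-- It is enough to test the relations of the previous lemma on a `K`-basis of `L`. This gives an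
injective left `B`-linear map from `B^ι` to `B^[L:K]`. -/
theorem card_le_finrank_of_linearIndependent_centralizer (L : Subalgebra K B)
    [FiniteDimensional K L] {ι : Type*} [Fintype ι] (b : ι → B)
    (hb : LinearIndependent (Subalgebra.centralizer K (L : Set B)) b) :
    Fintype.card ι ≤ Module.finrank K L := by
  let l := Module.finBasis K L
  let Φ : (ι → B) →ₗ[B] (Fin (Module.finrank K L) → B) :=
    { toFun := fun x i => ∑ j, x j * (l i : B) * b j
      map_add' := fun x y => by
        ext i
        simp [add_mul, Finset.sum_add_distrib]
      map_smul' := fun c x => by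
        ext i
        simp [Finset.mul_sum, mul_assoc] }
  have hΦ : Function.Injective Φ := by
    rw [injective_iff_map_eq_zero]
    intro x hx
    refine eq_zero_of_forall_sum_mul_mul_eq_zero L b hb x fun a ha => ?_
    have hrep : ((∑ i, l.repr ⟨a, ha⟩ i • l i : L) : B) = a := congrArg Subtype.val (l.sum_repr ⟨a, ha⟩)
    rw [AddSubmonoidClass.coe_finsetSum] at hrep
    have hx' : ∀ i, ∑ j, x j * (l i : B) * b j = 0 := fun i => congrFun hx i
    calc ∑ j, x j * a * b j
        = ∑ j, ∑ i, l.repr ⟨a, ha⟩ i • (x j * (l i : B) * b j) := by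
          refine Finset.sum_congr rfl fun j _ => ?_
          nth_rw 1 [← hrep]
          rw [Finset.mul_sum, Finset.sum_mul]
          refine Finset.sum_congr rfl fun i _ => ?_
          rw [Subalgebra.coe_smul, mul_smul_comm, smul_mul_assoc]
      _ = 0 := by
          rw [Finset.sum_comm]
          simp [← Finset.smul_sum, hx']
  have := LinearMap.finrank_le_finrank_of_injective hΦ
  simpa using this

/-- This half of the dimension formula for centralizers is enough: the final count supplies the
opposite bounds. -/
theorem finrank_le_finrank_mul_finrank_centralizer [FiniteDimensional K B] (L : Subalgebra K B) :
    Module.finrank K B ≤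
      Module.finrank K L * Module.finrank K (Subalgebra.centralizer K (L : Set B)) := by
  let C := Subalgebra.centralizer K (L : Set B)
  let _ : DivisionRing C := divisionRingOfFiniteDimensional K C
  have : Module.Finite C B := Module.Finite.of_restrictScalars_finite K C B
  have hb := card_le_finrank_of_linearIndependent_centralizer L _
    (Module.finBasis C B).linearIndependent
  rw [Fintype.card_fin] at hb
  rw [← Module.finrank_mul_finrank K C B, mul_comm]
  exact Nat.mul_le_mul_right _ hb

end Centralizer

/-! ### Cardinalities and cyclic automorphism groups of finite fields. -/

section FiniteField

theorem natCard_eq_pow_finrank_compHom {k F : Type*} [Ring k] [IsDomain k] [Finite k] [Ring F]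
    [Finite F] (φ : k →+* F) :
    Nat.card F = Nat.card k ^ (letI := Module.compHom F φ; Module.finrank k F) := by
  classical
  cases nonempty_fintype k
  let _ : DivisionRing k := Fintype.divisionRingOfIsDomain k
  let _ := Module.compHom F φ
  exact Module.natCard_eq_pow_finrank

variable {k F : Type*} [Field k] [Field F] [Finite F] [Algebra k F]

/-- By Artin's theorem, the degree of `F` over the fixed field of ⟨σ⟩, here `k`, is the order of
that group. -/
theorem orderOf_eq_finrank_of_fixed (σ : F ≃ₐ[k] F)
    (hfix : ∀ x, σ x = x → x ∈ (algebraMap k F).range) : orderOf σ = Module.finrank k F := by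
  have : Finite k := Finite.of_injective _ (algebraMap k F).injective
  have : FiniteDimensional k F := Module.Finite.of_finite
  have h : IntermediateField.fixedField (Subgroup.zpowers σ) = ⊥ := by
    rw [eq_bot_iff]
    intro x hx
    obtain ⟨c, hc⟩ := hfix x (hx ⟨σ, Subgroup.mem_zpowers σ⟩)
    exact IntermediateField.mem_bot.2 ⟨c, hc⟩
  have h2 := IntermediateField.finrank_fixedField_eq_card (Subgroup.zpowers σ)
  rw [h, Nat.card_zpowers] at h2
  rw [← h2, IntermediateField.finrank_bot']

/-- With m = [F:k] the order of σ, the power σ^i has order m / gcd(m, i), so its fixed field has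
degree gcd(m, i) ≤ i over `k`. -/
theorem finrank_le_of_forall_pow_fixed (σ : F ≃ₐ[k] F)
    (hfix : ∀ x, σ x = x → x ∈ (algebraMap k F).range) {i : ℕ} (hi : 0 < i) :
    Module.finrank k (IntermediateField.fixedField (Subgroup.zpowers (σ ^ i))) ≤ i := by
  have : Finite k := Finite.of_injective _ (algebraMap k F).injective
  have : FiniteDimensional k F := Module.Finite.of_finite
  have h1 := orderOf_eq_finrank_of_fixed σ hfix
  have h2 := IntermediateField.finrank_fixedField_eq_card (Subgroup.zpowers (σ ^ i))
  rw [Nat.card_zpowers, orderOf_pow, h1] at h2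
  have h3 := Module.finrank_mul_finrank k
    (IntermediateField.fixedField (Subgroup.zpowers (σ ^ i))) F
  have hpos := Module.finrank_pos (R := k) (M := F)
  have hg := Nat.gcd_pos_of_pos_left i hpos
  have h4 : 0 < Module.finrank k F / (Module.finrank k F).gcd i :=
    Nat.div_pos (Nat.le_of_dvd hpos (Nat.gcd_dvd_left _ _)) hg
  rw [h2] at h3
  have h5 : Module.finrank k (IntermediateField.fixedField (Subgroup.zpowers (σ ^ i))) =
      (Module.finrank k F).gcd i := by
    refine Nat.eq_of_mul_eq_mul_right h4 (h3.trans ?_)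
    exact (Nat.mul_div_cancel' (Nat.gcd_dvd_left _ _)).symm
  rw [h5]
  exact Nat.gcd_le_right _ hi

end FiniteField

/-! ### The same facts for finite domains, via Wedderburn's theorem. -/

section FiniteDomain

variable {k F : Type*} [Ring k] [IsDomain k] [Finite k] [Ring F] [IsDomain F] [Finite F]

/-- An automorphism of `F` with fixed ring `k` has order dividing the degree of `F` over `k`. -/
theorem iterate_finrank_eq_of_fixed (φ : k →+* F) (σ : F ≃+* F) (hφ : ∀ x, σ (φ x) = φ x)
    (hfix : ∀ x, σ x = x → x ∈ φ.range) (x : F) :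
    σ^[letI := Module.compHom F φ; Module.finrank k F] x = x := by
  let _ : Field k := (Finite.isDomain_to_isField k).toField
  let _ : Field F := (Finite.isDomain_to_isField F).toField
  let _ : Algebra k F := φ.toAlgebra
  let τ : F ≃ₐ[k] F := AlgEquiv.ofRingEquiv (f := σ) hφ
  have h1 := orderOf_eq_finrank_of_fixed τ hfix
  have h2 : (τ ^ orderOf τ) x = x := by rw [pow_orderOf_eq_one]; rfl
  rw [h1, AlgEquiv.coe_pow] at h2
  exact h2

/-- A ring whose image is fixed by the `i`-th iterate of `σ` has at most `|k| ^ i` elements. -/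
theorem natCard_le_pow_of_iterate_fixed (φ : k →+* F) (σ : F ≃+* F) (hφ : ∀ x, σ (φ x) = φ x)
    (hfix : ∀ x, σ x = x → x ∈ φ.range) {E : Type*} (ψ : E → F) (hψ : Function.Injective ψ)
    {i : ℕ} (hi : 0 < i) (h : ∀ y, σ^[i] (ψ y) = ψ y) :
    Nat.card E ≤ Nat.card k ^ i := by
  let _ : Field k := (Finite.isDomain_to_isField k).toField
  let _ : Field F := (Finite.isDomain_to_isField F).toField
  let _ : Algebra k F := φ.toAlgebra
  let τ : F ≃ₐ[k] F := AlgEquiv.ofRingEquiv (f := σ) hφ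
  let M := IntermediateField.fixedField (Subgroup.zpowers (τ ^ i))
  have hM : ∀ y, ψ y ∈ M := by
    rintro y ⟨g, hg⟩
    have hle : Subgroup.zpowers (τ ^ i) ≤ MulAction.stabilizer (F ≃ₐ[k] F) (ψ y) := by
      rw [Subgroup.zpowers_le, MulAction.mem_stabilizer_iff, AlgEquiv.smul_def, AlgEquiv.coe_pow]
      exact h y
    exact hle hg
  have h1 : Nat.card E ≤ Nat.card M :=
    Nat.card_le_card_of_injective (fun y => (⟨ψ y, hM y⟩ : M)) fun a b hab =>
      hψ (congrArg Subtype.val hab)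
  have : FiniteDimensional k F := Module.Finite.of_finite
  rw [Module.natCard_eq_pow_finrank (K := k) (V := M)] at h1
  exact h1.trans (Nat.pow_le_pow_right Nat.card_pos (finrank_le_of_forall_pow_fixed τ hfix hi))

end FiniteDomain

/-! ### Residual degrees and the two halves of [S:K] = ef. -/

section FundamentalIdentity

variable {K : Type*} [NontriviallyNormedField K] [IsUltrametricDist K] [LocallyCompactSpace K]
variable {B : Type*} [DivisionRing B] [Algebra K B] [FiniteDimensional K B]

theorem natCard_residueField {T S : Subalgebra K B} (h : T ≤ S) :
    Nat.card (ResidueField S) = Nat.card (ResidueField T) ^ residualDegree h :=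
  natCard_eq_pow_finrank_compHom (residueMap h)

theorem one_lt_natCard_residueField (S : Subalgebra K B) : 1 < Nat.card (ResidueField S) :=
  Finite.one_lt_card

theorem residualDegree_pos {T S : Subalgebra K B} (h : T ≤ S) : 0 < residualDegree h := by
  rw [Nat.pos_iff_ne_zero]
  intro h0
  have h1 := natCard_residueField h
  rw [h0, pow_zero] at h1
  exact (one_lt_natCard_residueField S).ne' h1

/-- Counting elements replaces a tower of module structures: degrees are the exponents of residue
field cardinalities. -/
theorem residualDegree_mul {R T S : Subalgebra K B} (h : R ≤ T) (h' : T ≤ S) :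
    residualDegree h * residualDegree h' = residualDegree (h.trans h') := by
  refine Nat.pow_right_injective (one_lt_natCard_residueField R) ?_
  change _ ^ _ = _ ^ _
  rw [pow_mul, ← natCard_residueField h, ← natCard_residueField h', ← natCard_residueField]

/-- The class of an element of `K` of absolute value at most `1` in the residue field of `K`. -/
noncomputable def scalarResidue (B : Type*) [DivisionRing B] [Algebra K B] [FiniteDimensional K B]
    (c : K) (hc : ‖c‖ ≤ 1) : ResidueField (⊥ : Subalgebra K B) :=
  Ideal.Quotient.mk _ ⟨algebraMap K B c, Subalgebra.algebraMap_mem _ c,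
    (absVal_algebraMap (B := B) c).trans_le hc⟩

theorem exists_scalarResidue_eq (a : ResidueField (⊥ : Subalgebra K B)) :
    ∃ (c : K) (hc : ‖c‖ ≤ 1), scalarResidue B c hc = a := by
  obtain ⟨⟨x, hx, hx1⟩, rfl⟩ := Ideal.Quotient.mk_surjective a
  obtain ⟨c, rfl⟩ := Algebra.mem_bot.1 hx
  exact ⟨c, (absVal_algebraMap (B := B) c).symm.trans_le hx1, rfl⟩

/-- A family in `S` whose residues form a basis of the residue field over that of `K`. -/
theorem exists_residue_basis (S : Subalgebra K B) :
    ∃ a : Fin (residualDegree (bot_le : ⊥ ≤ S)) → B,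
      (∀ i, a i ∈ S) ∧ (∀ i, absVal K (a i) ≤ 1) ∧
      (∀ x ∈ S, absVal K x ≤ 1 → ∃ c : Fin (residualDegree (bot_le : ⊥ ≤ S)) → K,
        absVal K (x - ∑ i, c i • a i) < 1) ∧
      ∀ c : Fin (residualDegree (bot_le : ⊥ ≤ S)) → K, (∀ i, ‖c i‖ ≤ 1) →
        absVal K (∑ i, c i • a i) < 1 → ∀ i, ‖c i‖ < 1 := by
  classical
  cases nonempty_fintype (ResidueField (⊥ : Subalgebra K B))
  let _ : DivisionRing (ResidueField (⊥ : Subalgebra K B)) := Fintype.divisionRingOfIsDomain _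
  let _ : Module (ResidueField (⊥ : Subalgebra K B)) (ResidueField S) :=
    Module.compHom _ (residueMap (bot_le : ⊥ ≤ S))
  have : Module.Finite (ResidueField (⊥ : Subalgebra K B)) (ResidueField S) :=
    Module.Finite.of_finite
  let β := Module.finBasis (ResidueField (⊥ : Subalgebra K B)) (ResidueField S)
  choose a ha using fun i => Ideal.Quotient.mk_surjective (β i)
  have hsum : ∀ (c : Fin (residualDegree (bot_le : ⊥ ≤ S)) → K) (hc : ∀ i, ‖c i‖ ≤ 1),
      ∃ hm : ∑ i, c i • (a i : B) ∈ integers S,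
      Ideal.Quotient.mk (maxIdeal S) ⟨∑ i, c i • (a i : B), hm⟩ =
        ∑ i, scalarResidue B (c i) (hc i) • β i := by
    intro c hc
    let t : Fin (residualDegree (bot_le : ⊥ ≤ S)) → integers S := fun i =>
      ⟨algebraMap K B (c i), S.algebraMap_mem _,
        (absVal_algebraMap (B := B) (c i)).trans_le (hc i)⟩ * a i
    have ht : ((∑ i, t i : integers S) : B) = ∑ i, c i • (a i : B) := by
      rw [AddSubmonoidClass.coe_finsetSum]
      exact Finset.sum_congr rfl fun i _ => (Algebra.smul_def _ _).symm
    have hm : ∑ i, c i • (a i : B) ∈ integers S := ht ▸ (∑ i, t i : integers S).2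
    refine ⟨hm, ?_⟩
    have : (⟨∑ i, c i • (a i : B), hm⟩ : integers S) = ∑ i, t i := Subtype.ext ht.symm
    rw [this, map_sum]
    refine Finset.sum_congr rfl fun i _ => ?_
    exact (map_mul _ _ _).trans (congrArg (_ * ·) (ha i))
  refine ⟨fun i => a i, fun i => (a i).2.1, fun i => (a i).2.2, ?_, ?_⟩
  · intro x hxS hx1
    choose c hc hcr using fun i => exists_scalarResidue_eq
      (β.repr (Ideal.Quotient.mk (maxIdeal S) ⟨x, hxS, hx1⟩) i)
    obtain ⟨hm, hs⟩ := hsum c hc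
    refine ⟨c, ?_⟩
    have h1 : Ideal.Quotient.mk (maxIdeal S) ⟨x, hxS, hx1⟩ =
        Ideal.Quotient.mk (maxIdeal S) ⟨∑ i, c i • (a i : B), hm⟩ := by
      refine Eq.trans ?_ hs.symm
      rw [← β.sum_repr (Ideal.Quotient.mk (maxIdeal S) ⟨x, hxS, hx1⟩)]
      exact Finset.sum_congr rfl fun i _ => congrArg (· • β i) (hcr i).symm
    exact residue_eq_iff.1 h1
  · intro c hc hlt i
    obtain ⟨hm, hs⟩ := hsum c hc
    have h0 : Ideal.Quotient.mk (maxIdeal S) ⟨∑ i, c i • (a i : B), hm⟩ = 0 :=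
      residue_eq_zero_iff.2 hlt
    have h1 := Fintype.linearIndependent_iff.1 β.linearIndependent _ (hs.symm.trans h0) i
    have h2 := residue_eq_zero_iff.1 h1
    rwa [absVal_algebraMap] at h2

/-- The products of lifts of a residue basis with 1, π, …, π^(e-1) span `S`, because their `K`-span
approximates every nonzero element to smaller relative error. -/
theorem finrank_le_mul_residualDegree (S : Subalgebra K B) {e : ℕ} (he : 0 < e)
    (heS : unifVal (⊥ : Subalgebra K B) = unifVal S ^ e) :
    Module.finrank K S ≤ e * residualDegree (bot_le : ⊥ ≤ S) := by
  obtain ⟨a, haS, ha1, hspan, -⟩ := exists_residue_basis S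
  let π : B := uniformizer S
  have hπ0 : π ≠ 0 := uniformizer_ne_zero S
  have hπS : π ∈ S := (uniformizer S).2.1
  obtain ⟨ϖ, hϖ⟩ := Algebra.mem_bot.1 (uniformizer (⊥ : Subalgebra K B)).2.1
  have hϖ0 : algebraMap K B ϖ ≠ 0 := by
    rw [hϖ]
    exact uniformizer_ne_zero _
  have hϖe : absVal K (algebraMap K B ϖ) = unifVal S ^ e := by
    rw [hϖ]
    exact heS
  let v : Fin e × Fin (residualDegree (bot_le : ⊥ ≤ S)) → B := fun p => a p.2 * π ^ (p.1 : ℕ)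
  let M := Submodule.span K (Set.range v)
  have hMS : M ≤ Subalgebra.toSubmodule S := by
    rw [Submodule.span_le]
    rintro _ ⟨p, rfl⟩
    exact S.mul_mem (haS _) (S.pow_mem hπS _)
  have hle : Subalgebra.toSubmodule S ≤ M := by
    refine le_of_exists_approx S M hMS fun x hxS hx0 => ?_
    obtain ⟨n, hn⟩ := exists_absVal_eq_zpow hxS hx0
    have he0 : (e : ℤ) ≠ 0 := by exact_mod_cast he.ne'
    obtain ⟨j, hj⟩ := Int.eq_ofNat_of_zero_le (Int.emod_nonneg n he0)
    have hje : j < e := by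
      have := Int.emod_lt_of_pos n (show (0 : ℤ) < e by exact_mod_cast he)
      omega
    -- Division with remainder, n = j + e(n / e), gives ρ(y) = ρ(x) with only powers of π below `e`;
    -- the remaining factor is a scalar.
    let y : B := π ^ j * algebraMap K B ϖ ^ (n / e)
    have hy0 : y ≠ 0 := mul_ne_zero (pow_ne_zero _ hπ0) (zpow_ne_zero _ hϖ0)
    have hyS : y ∈ S :=
      S.mul_mem (S.pow_mem hπS _) (zpow_mem_subalgebra S (S.algebraMap_mem _) _)
    have hyx : absVal K y = absVal K x := by
      rw [hn, absVal_mul, absVal_pow, absVal_zpow, hϖe, ← zpow_natCast, ← zpow_natCast,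
        ← zpow_mul, ← zpow_add₀ (unifVal_pos S).ne', ← hj, Int.emod_add_mul_ediv]
    have hu : absVal K (x * y⁻¹) ≤ 1 := by
      rw [absVal_mul, absVal_inv_eq, hyx, mul_inv_cancel₀ (absVal_pos hx0).ne']
    obtain ⟨c, hc⟩ := hspan _ (S.mul_mem hxS (inv_mem_subalgebra S hyS)) hu
    refine ⟨(∑ i, c i • a i) * y, ?_, ?_⟩
    · have hϖz : algebraMap K B ϖ ^ (n / e) = algebraMap K B (ϖ ^ (n / e)) :=
        (map_zpow₀ (algebraMap K B) _ _).symm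
      rw [Finset.sum_mul]
      refine M.sum_mem fun i _ => ?_
      have : c i • a i * y = (c i * ϖ ^ (n / e)) • v (⟨j, hje⟩, i) := by
        simp only [y, v, hϖz]
        rw [← Algebra.commutes, ← Algebra.smul_def, mul_smul_comm, smul_mul_assoc, smul_smul,
          mul_comm (c i)]
      rw [this]
      exact M.smul_mem _ (Submodule.subset_span ⟨_, rfl⟩)
    · have h1 : x - (∑ i, c i • a i) * y = (x * y⁻¹ - ∑ i, c i • a i) * y := by
        rw [sub_mul, inv_mul_cancel_right₀ hy0]
      rw [h1, absVal_mul, hyx]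
      exact mul_lt_of_lt_one_left (absVal_pos hx0) hc
  calc Module.finrank K S ≤ Module.finrank K M := Submodule.finrank_mono hle
    _ ≤ Fintype.card (Fin e × Fin (residualDegree (bot_le : ⊥ ≤ S))) :=
      finrank_range_le_card v
    _ = _ := by simp

/-- The same products are independent for `S = B`: different powers of π give values in different
classes modulo the values of `K`, and within one power the residue basis prevents cancellation. -/
theorem mul_residualDegree_le_finrank {e : ℕ}
    (heB : unifVal (⊥ : Subalgebra K B) = unifVal (⊤ : Subalgebra K B) ^ e) :
    e * residualDegree (bot_le : ⊥ ≤ (⊤ : Subalgebra K B)) ≤ Module.finrank K B := by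
  obtain ⟨a, -, ha1, -, hind⟩ := exists_residue_basis (⊤ : Subalgebra K B)
  let π : B := uniformizer (⊤ : Subalgebra K B)
  have hπ0 : π ≠ 0 := uniformizer_ne_zero _
  let v : Fin e × Fin (residualDegree (bot_le : ⊥ ≤ (⊤ : Subalgebra K B))) → B :=
    fun p => a p.2 * π ^ (p.1 : ℕ)
  suffices hv : LinearIndependent K v by
    simpa using hv.fintype_card_le_finrank
  rw [Fintype.linearIndependent_iff]
  intro c hc
  by_contra! hne
  obtain ⟨p₁, hp₁⟩ := hne
  let w : Fin e × Fin (residualDegree (bot_le : ⊥ ≤ (⊤ : Subalgebra K B))) → ℝ :=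
    fun p => ‖c p‖ * absVal K (π ^ (p.1 : ℕ))
  obtain ⟨p₀, -, hmax⟩ := Finset.exists_max_image Finset.univ w ⟨p₁, Finset.mem_univ _⟩
  have hπpos : ∀ j : ℕ, 0 < absVal K (π ^ j) := fun j => absVal_pos (pow_ne_zero _ hπ0)
  have hw0 : 0 < w p₀ :=
    (mul_pos (norm_pos_iff.2 hp₁) (hπpos _)).trans_le (hmax p₁ (Finset.mem_univ _))
  have hc0 : c p₀ ≠ 0 := fun h => by simp [w, h] at hw0
  have hval : ∀ d : K, d ≠ 0 → ∃ m : ℤ, ‖d‖ = unifVal (⊤ : Subalgebra K B) ^ ((e : ℤ) * m) := by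
    intro d hd
    obtain ⟨m, hm⟩ := exists_absVal_eq_zpow (K := K) (B := B) (S := ⊥) (x := algebraMap K B d)
      (Subalgebra.algebraMap_mem _ d) (by simpa using hd)
    refine ⟨m, ?_⟩
    rw [← absVal_algebraMap (B := B), hm, heB, zpow_mul, zpow_natCast]
  -- Nonzero scalars have value exponents divisible by `e`, so equal weights would force the two
  -- exponents of π, both below `e`, to agree.
  have hdiff : ∀ p, p.1 ≠ p₀.1 → w p < w p₀ := by
    intro p hp
    refine (hmax p (Finset.mem_univ _)).lt_of_ne fun heq => hp ?_
    have hcp : c p ≠ 0 := fun h => by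
      rw [← heq] at hw0
      simp [w, h] at hw0
    obtain ⟨m, hm⟩ := hval _ hcp
    obtain ⟨m₀, hm₀⟩ := hval _ hc0
    simp only [w, hm, hm₀, absVal_pow] at heq
    change _ * unifVal (⊤ : Subalgebra K B) ^ _ = _ * unifVal (⊤ : Subalgebra K B) ^ _ at heq
    rw [← zpow_natCast, ← zpow_natCast, ← zpow_add₀ (unifVal_pos _).ne',
      ← zpow_add₀ (unifVal_pos _).ne'] at heq
    have h1 := zpow_right_injective₀ (unifVal_pos _) (unifVal_lt_one _).ne heq
    have h2 := congrArg (· % (e : ℤ)) h1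
    simp only [Int.mul_add_emod_self_left] at h2
    have h3 := p.1.2
    have h4 := p₀.1.2
    rw [Int.emod_eq_of_lt (by omega) (by omega), Int.emod_eq_of_lt (by omega) (by omega)] at h2
    exact Fin.ext (by exact_mod_cast h2)
  have hterm : ∀ p, absVal K (c p • v p) ≤ w p := fun p => by
    rw [Algebra.smul_def, absVal_mul, absVal_algebraMap, absVal_mul]
    refine mul_le_mul_of_nonneg_left ?_ (norm_nonneg _)
    exact mul_le_of_le_one_left (absVal_nonneg _) (ha1 _)
  rw [Fintype.sum_prod_type, ← Finset.add_sum_erase _ _ (Finset.mem_univ p₀.1)] at hc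
  have hrest : absVal K (∑ j ∈ Finset.univ.erase p₀.1, ∑ i, c (j, i) • v (j, i)) < w p₀ :=
    absVal_sum_lt _ _ hw0 fun j hj => absVal_sum_lt _ _ hw0 fun i _ =>
      (hterm _).trans_lt (hdiff _ (Finset.ne_of_mem_erase hj))
  rw [eq_neg_of_add_eq_zero_right hc, absVal_neg] at hrest
  -- The block of the dominant term equals minus the rest, so its value is below `w p₀`. Dividing by
  -- `c p₀` leaves integral coefficients that should all reduce to zero, although the one at `p₀` is
  -- 1.
  have hfac : ∑ i, c (p₀.1, i) • v (p₀.1, i) =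
      algebraMap K B (c p₀) * (∑ i, (c (p₀.1, i) / c p₀) • a i) * π ^ (p₀.1 : ℕ) := by
    rw [Finset.mul_sum, Finset.sum_mul]
    refine Finset.sum_congr rfl fun i _ => ?_
    rw [← Algebra.smul_def, smul_smul, mul_div_cancel₀ _ hc0, smul_mul_assoc]
  rw [hfac, absVal_mul, absVal_mul, absVal_algebraMap, mul_right_comm] at hrest
  have hlt := (mul_lt_iff_lt_one_right hw0).1 hrest
  have hle : ∀ i, ‖c (p₀.1, i) / c p₀‖ ≤ 1 := fun i => by
    have h1 := hmax (p₀.1, i) (Finset.mem_univ _)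
    rw [norm_div, div_le_one (norm_pos_iff.2 hc0)]
    exact le_of_mul_le_mul_right h1 (hπpos _)
  have h1 := hind _ hle hlt p₀.2
  rw [Prod.mk.eta, div_self hc0, norm_one] at h1
  exact lt_irrefl _ h1

end FundamentalIdentity

/-! ### Lifting roots of unity from the residue field. -/

section Teichmuller

variable {K : Type*} [NontriviallyNormedField K] [IsUltrametricDist K] [LocallyCompactSpace K]
variable {B : Type*} [DivisionRing B] [Algebra K B] [FiniteDimensional K B]

theorem exists_generator_of_finite_domain (F : Type*) [Ring F] [IsDomain F] [Finite F] :
    ∃ g : F, g ^ (Nat.card F - 1) = 1 ∧ (∀ i j : ℕ, g ^ i = g ^ j → i ≡ j [MOD Nat.card F - 1]) ∧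
      ∀ x : F, x ≠ 0 → ∃ k : ℕ, g ^ k = x := by
  let _ : Field F := (Finite.isDomain_to_isField F).toField
  obtain ⟨g, hg⟩ := IsCyclic.exists_generator (α := Fˣ)
  have hord : orderOf g = Nat.card F - 1 := by
    rw [orderOf_eq_card_of_forall_mem_zpowers hg, Nat.card_units]
  refine ⟨g, ?_, fun i j hij => ?_, fun x hx => ?_⟩
  · rw [← hord]
    exact congrArg Units.val (pow_orderOf_eq_one g)
  · rw [← hord, ← pow_eq_pow_iff_modEq]
    exact Units.ext hij
  · obtain ⟨k, hk⟩ := mem_powers_iff_mem_zpowers.2 (hg (Units.mk0 x hx))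
    exact ⟨k, by simpa using congrArg Units.val hk⟩

theorem natCast_natCard_eq_zero (F : Type*) [Ring F] [Finite F] : (Nat.card F : F) = 0 := by
  cases nonempty_fintype F
  rw [Nat.card_eq_fintype_card, Nat.cast_card_eq_zero]

theorem absVal_pow_sub_pow_le {x y : B} (hx : absVal K x ≤ 1) (hy : absVal K y ≤ 1) (n : ℕ) :
    absVal K (x ^ n - y ^ n) ≤ absVal K (x - y) := by
  induction n with
  | zero => simpa [absVal_zero] using absVal_nonneg _
  | succ n ih =>
    have h : x ^ (n + 1) - y ^ (n + 1) = x ^ n * (x - y) + (x ^ n - y ^ n) * y := by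
      rw [pow_succ, pow_succ]
      noncomm_ring
    rw [h]
    refine (absVal_add_le _ _).trans (max_le ?_ ?_)
    · rw [absVal_mul, absVal_pow]
      exact mul_le_of_le_one_left (absVal_nonneg _) (pow_le_one₀ (absVal_nonneg _) hx)
    · rw [absVal_mul]
      exact (mul_le_of_le_one_right (absVal_nonneg _) hy).trans ih

variable (K B) in
/-- The number of elements of the residue field of `B`. -/
noncomputable abbrev residueCard : ℕ := Nat.card (ResidueField (⊤ : Subalgebra K B))

theorem absVal_residueCard_lt_one : absVal K (residueCard K B : B) < 1 := by
  have h : Ideal.Quotient.mk (maxIdeal (⊤ : Subalgebra K B))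
      ((residueCard K B : ℕ) : integers (⊤ : Subalgebra K B)) = 0 := by
    rw [map_natCast]
    exact natCast_natCard_eq_zero _
  simpa using residue_eq_zero_iff.1 h

/-- Factor x^q - 1 as (1 + x + … + x^(q-1))(x - 1). The first factor is congruent to q, hence to 0,
so its value is at most that of a uniformizer. -/
theorem absVal_pow_residueCard_sub_one_le {x : B} (hx : absVal K (x - 1) < 1) :
    absVal K (x ^ residueCard K B - 1) ≤
      unifVal (⊤ : Subalgebra K B) * absVal K (x - 1) := by
  have hx1 : absVal K x = 1 := by
    rw [← absVal_one (K := K) (B := B)]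
    exact absVal_eq_of_sub_lt (by rwa [absVal_one])
  rw [← geom_sum_mul, absVal_mul]
  refine mul_le_mul_of_nonneg_right (absVal_le_unifVal Algebra.mem_top ?_) (absVal_nonneg _)
  have h : ∑ i ∈ Finset.range (residueCard K B), x ^ i =
      ∑ i ∈ Finset.range (residueCard K B), (x ^ i - 1) + (residueCard K B : B) := by
    simp
  rw [h]
  refine (absVal_add_le _ _).trans_lt (max_lt (absVal_sum_lt _ _ one_pos fun i _ => ?_)
    absVal_residueCard_lt_one)
  have h1 := absVal_pow_sub_pow_le hx1.le (absVal_one (K := K)).le i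
  rw [one_pow] at h1
  exact h1.trans_lt hx

theorem absVal_pow_residueCard_pow_sub_one_le {x : B} (hx : absVal K (x - 1) < 1) (m : ℕ) :
    absVal K (x ^ residueCard K B ^ m - 1) ≤ unifVal (⊤ : Subalgebra K B) ^ m := by
  have h0 := unifVal_pos (⊤ : Subalgebra K B)
  have h1 := unifVal_lt_one (⊤ : Subalgebra K B)
  suffices absVal K (x ^ residueCard K B ^ m - 1) ≤ unifVal (⊤ : Subalgebra K B) ^ m ∧
      absVal K (x ^ residueCard K B ^ m - 1) < 1 from this.1
  induction m with
  | zero => simpa using ⟨hx.le, hx⟩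
  | succ m ih =>
    have h2 := absVal_pow_residueCard_sub_one_le ih.2
    rw [← pow_mul, ← pow_succ] at h2
    refine ⟨h2.trans ?_, h2.trans_lt ?_⟩
    · rw [pow_succ' (unifVal _)]
      exact mul_le_mul_of_nonneg_left ih.1 h0.le
    · exact mul_lt_one_of_nonneg_of_lt_one_left h0.le h1 ih.2.le

/-- Lifting of roots of unity from the residue field of `B`. -/
theorem exists_pow_eq_one_of_absVal_lt {a : B} {N : ℕ} (ha1 : absVal K a ≤ 1)
    (haN : absVal K (a ^ N - 1) < 1) (haq : absVal K (a ^ residueCard K B - a) < 1) :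
    ∃ ζ : B, ζ ^ N = 1 ∧ absVal K (ζ - a) < 1 := by
  -- All terms stay congruent to `a`, while their `N`-th powers tend to 1. By compactness a
  -- subsequence converges, and its limit is the required root of unity.
  let u : ℕ → B := fun m => a ^ residueCard K B ^ m
  have hu1 : ∀ m, absVal K (u m) ≤ 1 := fun m => by
    rw [absVal_pow]
    exact pow_le_one₀ (absVal_nonneg _) ha1
  have hua : ∀ m, absVal K (u m - a) < 1 := fun m => by
    induction m with
    | zero => simp [u, absVal_zero]
    | succ m ih =>
      have h1 := absVal_pow_sub_pow_le (hu1 m) ha1 (residueCard K B)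
      have h2 : u (m + 1) - a =
          (u m ^ residueCard K B - a ^ residueCard K B) + (a ^ residueCard K B - a) := by
        simp only [u]
        rw [← pow_mul, ← pow_succ]
        abel
      rw [h2]
      exact (absVal_add_le _ _).trans_lt (max_lt (h1.trans_lt ih) haq)
  have huN : ∀ m, absVal K (u m ^ N - 1) ≤ unifVal (⊤ : Subalgebra K B) ^ m := fun m => by
    have h1 := absVal_pow_residueCard_pow_sub_one_le haN m
    rwa [← pow_mul, mul_comm, pow_mul] at h1
  obtain ⟨ζ, hζ1, φ, hφ, hlim⟩ := exists_subseq_tendsto u hu1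
  refine ⟨ζ, ?_, ?_⟩
  · have hlim2 : Filter.Tendsto (fun n => unifVal (⊤ : Subalgebra K B) ^ φ n) Filter.atTop
        (nhds 0) :=
      (tendsto_pow_atTop_nhds_zero_of_lt_one (unifVal_pos _).le (unifVal_lt_one _)).comp
        hφ.tendsto_atTop
    have hlim3 := hlim.max hlim2
    rw [max_self] at hlim3
    have hle : ∀ n, absVal K (ζ ^ N - 1) ≤
        max (absVal K (u (φ n) - ζ)) (unifVal (⊤ : Subalgebra K B) ^ φ n) := fun n => by
      have h1 : ζ ^ N - 1 = (u (φ n) ^ N - 1) - (u (φ n) ^ N - ζ ^ N) := by abel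
      rw [h1]
      refine (absVal_sub_le _ _).trans (max_le ?_ ?_)
      · exact (huN _).trans (le_max_right _ _)
      · exact (absVal_pow_sub_pow_le (hu1 _) hζ1 N).trans (le_max_left _ _)
    have h0 := ge_of_tendsto' hlim3 hle
    exact sub_eq_zero.1 (absVal_eq_zero_iff.1 (le_antisymm h0 (absVal_nonneg _)))
  · obtain ⟨n, hn⟩ := (hlim.eventually_lt_const one_pos).exists
    have h1 : ζ - a = (u (φ n) - a) - (u (φ n) - ζ) := by abel
    rw [h1]
    exact (absVal_sub_le _ _).trans_lt (max_lt (hua _) hn)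

variable (K B) in
/-- `B` contains a root of unity that generates the multiplicative group of the residue field. -/
theorem exists_residue_generator :
    ∃ ζ : B, ζ ^ (residueCard K B - 1) = 1 ∧ absVal K ζ = 1 ∧
      (∀ x : B, absVal K x = 1 → ∃ k : ℕ, absVal K (x - ζ ^ k) < 1) ∧
      ∀ i j : ℕ, absVal K (ζ ^ i - ζ ^ j) < 1 → ζ ^ i = ζ ^ j := by
  have hq : 1 < residueCard K B := one_lt_natCard_residueField _
  obtain ⟨g, hg, hginj, hgen⟩ := exists_generator_of_finite_domain (ResidueField (⊤ : Subalgebra K B))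
  obtain ⟨a, rfl⟩ := Ideal.Quotient.mk_surjective g
  obtain ⟨ζ, hζN, hζa⟩ := exists_pow_eq_one_of_absVal_lt (K := K) (a := (a : B))
    (N := residueCard K B - 1) a.2.2
    (residue_eq_iff (x := a ^ (residueCard K B - 1)) (y := 1).1 (by
      rw [map_pow, map_one, hg]))
    (residue_eq_iff (x := a ^ residueCard K B) (y := a).1 (by
      rw [map_pow]
      conv_lhs => rw [← Nat.sub_add_cancel hq.le, pow_succ, hg, one_mul]))
  have hζ1 : absVal K ζ = 1 := by
    have h1 := absVal_pow (K := K) ζ (residueCard K B - 1)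
    rw [hζN, absVal_one] at h1
    exact (pow_eq_one_iff_of_nonneg (absVal_nonneg _) (by omega)).1 h1.symm
  let z : integers (⊤ : Subalgebra K B) := ⟨ζ, Algebra.mem_top, hζ1.le⟩
  have hz : Ideal.Quotient.mk (maxIdeal (⊤ : Subalgebra K B)) z = Ideal.Quotient.mk _ a :=
    residue_eq_iff.2 hζa
  refine ⟨ζ, hζN, hζ1, fun x hx => ?_, fun i j hij => ?_⟩
  · obtain ⟨k, hk⟩ := hgen (Ideal.Quotient.mk _ ⟨x, Algebra.mem_top, hx.le⟩) fun h0 =>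
      (residue_eq_zero_iff.1 h0).ne hx
    rw [← hz, ← map_pow] at hk
    exact ⟨k, residue_eq_iff.1 hk.symm⟩
  · have h1 : Ideal.Quotient.mk (maxIdeal (⊤ : Subalgebra K B)) (z ^ i) =
        Ideal.Quotient.mk _ (z ^ j) := residue_eq_iff.2 hij
    rw [map_pow, map_pow, hz] at h1
    rw [pow_eq_pow_mod i hζN, pow_eq_pow_mod j hζN, hginj i j h1]

end Teichmuller

/-! ### Conjugation on the residue field and a normalized uniformizer. -/

section Conjugation

variable {K : Type*} [NontriviallyNormedField K] [IsUltrametricDist K] [LocallyCompactSpace K]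
variable {B : Type*} [DivisionRing B] [Algebra K B] [FiniteDimensional K B]

/-- Conjugation by `y` on the ring of integers of `B`. -/
noncomputable def conjIntegers (y : B) (hy : y ≠ 0) :
    integers (⊤ : Subalgebra K B) →+* integers (⊤ : Subalgebra K B) where
  toFun x := ⟨y * x * y⁻¹, Algebra.mem_top, (absVal_conj hy _).trans_le x.2.2⟩
  map_one' := Subtype.ext (by simp [hy])
  map_zero' := Subtype.ext (by simp)
  map_add' a b := Subtype.ext (by simp [mul_add, add_mul])
  map_mul' a b := Subtype.ext (by simp [mul_assoc, hy])

/-- Conjugation by `y` on the residue field of `B`. -/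
noncomputable def conjResidueHom (y : B) (hy : y ≠ 0) :
    ResidueField (⊤ : Subalgebra K B) →+* ResidueField (⊤ : Subalgebra K B) :=
  Ideal.Quotient.lift (maxIdeal ⊤) ((Ideal.Quotient.mk (maxIdeal ⊤)).comp (conjIntegers y hy))
    fun a ha => residue_eq_zero_iff.2 ((absVal_conj hy (a : B)).trans_lt ha)

theorem conjResidueHom_bijective (y : B) (hy : y ≠ 0) :
    Function.Bijective (conjResidueHom (K := K) y hy) := by
  rw [← Finite.injective_iff_bijective, injective_iff_map_eq_zero]
  intro a ha
  obtain ⟨x, rfl⟩ := Ideal.Quotient.mk_surjective a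
  have h := residue_eq_zero_iff (x := conjIntegers y hy x).1 ha
  exact residue_eq_zero_iff.2 ((absVal_conj hy (x : B)).symm.trans_lt h)

/-- Conjugation by `y` as an automorphism of the residue field of `B`. -/
noncomputable def conjResidue (y : B) (hy : y ≠ 0) :
    ResidueField (⊤ : Subalgebra K B) ≃+* ResidueField (⊤ : Subalgebra K B) :=
  RingEquiv.ofBijective (conjResidueHom y hy) (conjResidueHom_bijective y hy)

theorem conjResidue_mk (y : B) (hy : y ≠ 0) (x : integers (⊤ : Subalgebra K B)) :
    conjResidue y hy (Ideal.Quotient.mk _ x) = Ideal.Quotient.mk _ (conjIntegers y hy x) := rfl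

theorem conjResidue_iterate_mk (y : B) (hy : y ≠ 0) (n : ℕ) (x : integers (⊤ : Subalgebra K B)) :
    (conjResidue y hy)^[n] (Ideal.Quotient.mk _ x) =
      Ideal.Quotient.mk _ (conjIntegers (y ^ n) (pow_ne_zero n hy) x) := by
  induction n with
  | zero =>
    refine congrArg (Ideal.Quotient.mk _) (Subtype.ext ?_)
    change (x : B) = y ^ 0 * x * (y ^ 0)⁻¹
    simp
  | succ n ih =>
    rw [Function.iterate_succ_apply', ih, conjResidue_mk]
    refine congrArg _ (Subtype.ext ?_)
    simp only [conjIntegers, RingHom.coe_mk, MonoidHom.coe_mk, OneHom.coe_mk]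
    rw [pow_succ', mul_inv_rev]
    simp only [mul_assoc]

theorem conjResidue_residueMap_bot (y : B) (hy : y ≠ 0) (a : ResidueField (⊥ : Subalgebra K B)) :
    conjResidue y hy (residueMap bot_le a) = residueMap bot_le a := by
  obtain ⟨c, hc, rfl⟩ := exists_scalarResidue_eq a
  refine congrArg (Ideal.Quotient.mk (maxIdeal (⊤ : Subalgebra K B))) (Subtype.ext ?_)
  change y * algebraMap K B c * y⁻¹ = algebraMap K B c
  rw [← Algebra.commutes, mul_inv_cancel_right₀ hy]

/-- A uniformizing parameter can be changed so that it normalizes the group generated by `ζ`. -/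
theorem exists_mul_eq_pow_mul {ζ π : B} {N s : ℕ} (hN : absVal K ((N + 1 : ℕ) : B) < 1)
    (hζN : ζ ^ N = 1) (hζ1 : absVal K ζ = 1) (hπ : π ≠ 0)
    (hs : absVal K (π * ζ * π⁻¹ - ζ ^ s) < 1) :
    ∃ y : B, absVal K y = absVal K π ∧ y * ζ = ζ ^ s * y := by
  have hζ0 : ζ ≠ 0 := fun h => by simp [h, absVal_zero] at hζ1
  let ξ : B := ζ ^ s
  have hξ0 : ξ ≠ 0 := pow_ne_zero _ hζ0
  have hξ1 : absVal K ξ = 1 := by rw [absVal_pow, hζ1, one_pow]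
  have hξN : ξ ^ N = 1 := by rw [← pow_mul, mul_comm, pow_mul, hζN, one_pow]
  -- The sum of these twisted conjugates over a full period `N` intertwines ζ and ξ: right
  -- multiplication by ζ is a shift of the index followed by left multiplication by ξ.
  let f : ℕ → B := fun i => (ξ ^ i)⁻¹ * π * ζ ^ i
  have hf : ∀ i, f i * ζ = ξ * f (i + 1) := fun i => by
    simp only [f]
    rw [pow_succ ξ, mul_inv_rev, pow_succ]
    simp only [mul_assoc, mul_inv_cancel_left₀ hξ0]
  refine ⟨∑ i ∈ Finset.range N, f i, ?_, ?_⟩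
  · have hconj : ∀ i, (π * ζ * π⁻¹) ^ i = π * ζ ^ i * π⁻¹ := fun i => by
      induction i with
      | zero => simp [hπ]
      | succ i ih =>
        rw [pow_succ, ih, pow_succ]
        simp [mul_assoc, hπ]
    have hterm : ∀ i, absVal K (f i - π) < absVal K π := fun i => by
      have h1 : f i - π = (ξ ^ i)⁻¹ * ((π * ζ * π⁻¹) ^ i - ξ ^ i) * π := by
        rw [hconj, mul_sub, sub_mul, inv_mul_cancel₀ (pow_ne_zero i hξ0), one_mul]
        simp [f, mul_assoc, hπ]
      have h2 := absVal_pow_sub_pow_le (K := K) (x := π * ζ * π⁻¹) (y := ξ)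
        ((absVal_conj hπ ζ).trans hζ1).le hξ1.le i
      rw [h1, absVal_mul, absVal_mul, absVal_inv_eq, absVal_pow, hξ1, one_pow, inv_one, one_mul]
      exact mul_lt_of_lt_one_left (absVal_pos hπ) (h2.trans_lt hs)
    -- Each summand is close to π, so the sum is close to `N` times π, and `N` is congruent to -1.
    -- The comparison is therefore with -π.
    rw [← absVal_neg π]
    refine absVal_eq_of_sub_lt ?_
    have h3 : ∑ i ∈ Finset.range N, f i - -π =
        ∑ i ∈ Finset.range N, (f i - π) + ((N + 1 : ℕ) : B) * π := by
      rw [Finset.sum_sub_distrib, Finset.sum_const, Finset.card_range, nsmul_eq_mul]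
      push_cast
      rw [add_mul, one_mul]
      abel
    rw [h3, absVal_neg]
    refine (absVal_add_le _ _).trans_lt (max_lt ?_ ?_)
    · exact absVal_sum_lt _ _ (absVal_pos hπ) fun i _ => hterm i
    · rw [absVal_mul]
      exact mul_lt_of_lt_one_left (absVal_pos hπ) hN
  · have hper : f N = f 0 := by simp [f, hξN, hζN]
    have hshift : ∑ i ∈ Finset.range N, f (i + 1) = ∑ i ∈ Finset.range N, f i := by
      have h1 := Finset.sum_range_succ f N
      rw [Finset.sum_range_succ', hper] at h1
      exact add_right_cancel h1
    rw [Finset.sum_mul]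
    simp only [hf]
    rw [← Finset.mul_sum, hshift]

/-- The centralizer of α contains every ζ^k y^n, and such products approximate each nonzero element
of `B`. Thus it is all of `B`, and α is central. -/
theorem exists_algebraMap_eq_of_commute [Algebra.IsCentral K B] {ζ y α : B}
    (hy : absVal K y = unifVal (⊤ : Subalgebra K B))
    (hζ : ∀ x : B, absVal K x = 1 → ∃ k : ℕ, absVal K (x - ζ ^ k) < 1)
    (hαζ : Commute α ζ) (hαy : Commute α y) : ∃ c : K, algebraMap K B c = α := by
  have hy0 : y ≠ 0 := fun h => (unifVal_pos (⊤ : Subalgebra K B)).ne' (by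
    rw [← hy, h, absVal_zero])
  let A : Subalgebra K B := Subalgebra.centralizer K {α}
  have hA : ∀ x, x ∈ A ↔ Commute α x := fun x => by
    simp only [A, Subalgebra.mem_centralizer_iff, Set.mem_singleton_iff, forall_eq]
    rfl
  have htop := le_of_exists_approx (⊤ : Subalgebra K B) (Subalgebra.toSubmodule A)
    (fun b _ => (Algebra.mem_top : b ∈ (⊤ : Subalgebra K B))) fun x _ hx0 => by
      obtain ⟨n, hn⟩ := exists_absVal_eq_zpow (K := K) (S := ⊤) (x := x) Algebra.mem_top hx0
      have hyn : absVal K (y ^ n) = absVal K x := by rw [absVal_zpow, hy, hn]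
      have hyn0 : y ^ n ≠ 0 := zpow_ne_zero n hy0
      obtain ⟨k, hk⟩ := hζ (x * (y ^ n)⁻¹) (by
        rw [absVal_mul, ← hyn, absVal_inv hyn0])
      refine ⟨ζ ^ k * y ^ n, A.mul_mem (A.pow_mem ((hA _).2 hαζ) k)
        (zpow_mem_subalgebra A ((hA _).2 hαy) n), ?_⟩
      have h1 : x - ζ ^ k * y ^ n = (x * (y ^ n)⁻¹ - ζ ^ k) * y ^ n := by
        rw [sub_mul, inv_mul_cancel_right₀ hyn0]
      rw [h1, absVal_mul, hyn]
      exact mul_lt_of_lt_one_left (absVal_pos hx0) hk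
  have hcen : α ∈ Subalgebra.center K B := by
    rw [Subalgebra.mem_center_iff]
    intro b
    exact ((hA b).1 (htop (Algebra.mem_top : b ∈ (⊤ : Subalgebra K B)))).symm
  rw [Algebra.IsCentral.center_eq_bot] at hcen
  exact Algebra.mem_bot.1 hcen

variable (K B) in
/-- There is a uniformizing parameter of `B` that acts on the residue field of `B` by conjugation
with fixed field the residue field of `K`, and whose `f(B/K)`-th power is in `K`. -/
theorem exists_uniformizer_conj_fixed [Algebra.IsCentral K B] :
    ∃ (y : B) (hy : y ≠ 0), absVal K y = unifVal (⊤ : Subalgebra K B) ∧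
      (∀ a, conjResidue (K := K) y hy a = a →
        a ∈ (residueMap (bot_le : ⊥ ≤ (⊤ : Subalgebra K B))).range) ∧
      ∃ c : K, algebraMap K B c = y ^ residualDegree (bot_le : ⊥ ≤ (⊤ : Subalgebra K B)) := by
  obtain ⟨ζ, hζN, hζ1, hζgen, hζinj⟩ := exists_residue_generator K B
  have hq : 1 < residueCard K B := one_lt_natCard_residueField _
  have hπ0 := uniformizer_ne_zero (⊤ : Subalgebra K B)
  obtain ⟨s, hs⟩ := hζgen _ ((absVal_conj (K := K) hπ0 ζ).trans hζ1)
  obtain ⟨y, hyval, hyζ⟩ := exists_mul_eq_pow_mul (K := K) (N := residueCard K B - 1) (by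
    rw [Nat.sub_add_cancel hq.le]
    exact absVal_residueCard_lt_one) hζN hζ1 hπ0 hs
  have hy0 : y ≠ 0 := fun h => (unifVal_pos (⊤ : Subalgebra K B)).ne' (by
    rw [unifVal, ← hyval, h, absVal_zero])
  have hconj : ∀ m k : ℕ, y ^ m * ζ ^ k * (y ^ m)⁻¹ = ζ ^ (s ^ m * k) := fun m k => by
    have h1 : SemiconjBy y ζ (ζ ^ s) := hyζ
    have h2 : ∀ m : ℕ, SemiconjBy (y ^ m) ζ (ζ ^ s ^ m) := fun m => by
      induction m with
      | zero => simp
      | succ m ih =>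
        rw [pow_succ', pow_succ', pow_mul]
        exact (h1.pow_right _).mul_left ih
    have h3 := ((h2 m).pow_right k).eq
    rw [h3, mul_inv_cancel_right₀ (pow_ne_zero m hy0), pow_mul]
  let z : integers (⊤ : Subalgebra K B) := ⟨ζ, Algebra.mem_top, hζ1.le⟩
  -- Conjugation by `y ^ m` permutes the powers of ζ, and congruent powers are equal, so being fixed
  -- modulo the maximal ideal becomes actual commutation.
  have hexact : ∀ m k : ℕ, (conjResidue (K := K) y hy0)^[m] (Ideal.Quotient.mk _ (z ^ k)) =
      Ideal.Quotient.mk _ (z ^ k) → Commute (y ^ m) (ζ ^ k) := fun m k h => by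
    rw [conjResidue_iterate_mk, residue_eq_iff] at h
    change absVal K (y ^ m * ζ ^ k * (y ^ m)⁻¹ - ζ ^ k) < 1 at h
    have h1 := hconj m k
    rw [h1] at h
    rw [hζinj _ _ h] at h1
    exact (mul_inv_eq_iff_eq_mul₀ (pow_ne_zero m hy0)).1 h1
  have hfix : ∀ a, conjResidue (K := K) y hy0 a = a →
      a ∈ (residueMap (bot_le : ⊥ ≤ (⊤ : Subalgebra K B))).range := by
    intro a ha
    obtain ⟨x, rfl⟩ := Ideal.Quotient.mk_surjective a
    rcases x.2.2.lt_or_eq with hx | hx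
    · exact ⟨0, by rw [map_zero, residue_eq_zero_iff.2 hx]⟩
    obtain ⟨k, hk⟩ := hζgen x hx
    have hxk : Ideal.Quotient.mk (maxIdeal (⊤ : Subalgebra K B)) x = Ideal.Quotient.mk _ (z ^ k) :=
      residue_eq_iff.2 hk
    rw [hxk] at ha ⊢
    have hcomm := hexact 1 k ha
    rw [pow_one] at hcomm
    obtain ⟨c, hc⟩ := exists_algebraMap_eq_of_commute hyval hζgen
      ((Commute.refl ζ).pow_left k) hcomm.symm
    have hc1 : ‖c‖ ≤ 1 := by
      rw [← absVal_algebraMap (B := B), hc, absVal_pow, hζ1, one_pow]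
    exact ⟨scalarResidue B c hc1, congrArg (Ideal.Quotient.mk _) (Subtype.ext hc)⟩
  refine ⟨y, hy0, hyval, hfix, exists_algebraMap_eq_of_commute hyval hζgen ?_
    ((Commute.refl y).pow_left _)⟩
  -- The f(B/K)-th iterate of σ is the identity, so `y ^ f(B/K)` commutes with ζ as well as with
  -- `y`.
  have h1 := hexact (residualDegree (bot_le : ⊥ ≤ (⊤ : Subalgebra K B))) 1
    (iterate_finrank_eq_of_fixed (residueMap bot_le) (conjResidue y hy0)
      (conjResidue_residueMap_bot y hy0) hfix _)
  rwa [pow_one] at h1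

end Conjugation

/-! ### Inequalities between residual degrees and ramification indices. -/

section Comparison

variable {K : Type*} [NontriviallyNormedField K] [IsUltrametricDist K] [LocallyCompactSpace K]
variable {B : Type*} [DivisionRing B] [Algebra K B] [FiniteDimensional K B]
variable [Algebra.IsCentral K B]

/-- The element `y ^ f` lies in `K`, so its value exponent `f` is a multiple of `e`. -/
theorem ramification_le_residualDegree {e : ℕ}
    (he : unifVal (⊥ : Subalgebra K B) = unifVal (⊤ : Subalgebra K B) ^ e) :
    e ≤ residualDegree (bot_le : ⊥ ≤ (⊤ : Subalgebra K B)) := by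
  obtain ⟨y, hy0, hy, -, c, hc⟩ := exists_uniformizer_conj_fixed K B
  have h0 := unifVal_pos (⊤ : Subalgebra K B)
  obtain ⟨m, hm⟩ := exists_absVal_eq_zpow (K := K) (B := B) (S := ⊥) (x := algebraMap K B c)
    (Subalgebra.algebraMap_mem _ c) (by rw [hc]; exact pow_ne_zero _ hy0)
  rw [hc, absVal_pow, hy, he, ← zpow_natCast, ← zpow_natCast, ← zpow_mul] at hm
  have h1 := zpow_right_injective₀ h0 (unifVal_lt_one _).ne hm
  exact Nat.le_of_dvd (residualDegree_pos _) (Int.natCast_dvd_natCast.1 ⟨m, h1⟩)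

/-- If `C` and `L` commute, then `f(L/K) ≤ e(B/C)`. -/
theorem residualDegree_le_of_commute {L C : Subalgebra K B} (hLC : ∀ x ∈ C, ∀ l ∈ L, Commute x l)
    {d : ℕ} (hd : 0 < d) (hC : unifVal C = unifVal (⊤ : Subalgebra K B) ^ d) :
    residualDegree (bot_le : ⊥ ≤ L) ≤ d := by
  obtain ⟨y, hy0, hy, hfix, -⟩ := exists_uniformizer_conj_fixed K B
  let x : B := uniformizer C
  have hx0 : x ≠ 0 := uniformizer_ne_zero C
  have hyd0 : y ^ d ≠ 0 := pow_ne_zero d hy0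
  -- Since `x` centralizes `L`, conjugation by `y ^ d` agrees on `L` with conjugation by the unit
  -- `u`, which is trivial on the commutative residue field.
  let u : B := (y ^ d) * x⁻¹
  have hu0 : u ≠ 0 := mul_ne_zero hyd0 (inv_ne_zero hx0)
  have hu : absVal K u = 1 := by
    have h1 : absVal K x = absVal K (y ^ d) := by
      rw [absVal_pow, hy]
      exact hC
    rw [absVal_mul, absVal_inv_eq, ← h1, mul_inv_cancel₀ (absVal_pos hx0).ne']
  let u' : integers (⊤ : Subalgebra K B) := ⟨u, Algebra.mem_top, hu.le⟩
  have hfixL : ∀ a : ResidueField L, (conjResidue (K := K) y hy0)^[d] (residueMap le_top a) =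
      residueMap le_top a := by
    intro a
    obtain ⟨l, rfl⟩ := Ideal.Quotient.mk_surjective a
    rw [residueMap_mk, conjResidue_iterate_mk]
    have h1 : conjIntegers (y ^ d) (pow_ne_zero d hy0)
        (Subring.inclusion (integers_mono le_top) l) * u' =
        u' * Subring.inclusion (integers_mono le_top) l := by
      refine Subtype.ext ?_
      change y ^ d * (l : B) * (y ^ d)⁻¹ * (y ^ d * x⁻¹) = y ^ d * x⁻¹ * l
      have h2 : (l : B) * x⁻¹ = x⁻¹ * l :=
        ((hLC x (uniformizer C).2.1 l l.2.1).inv_left₀.eq).symm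
      rw [mul_assoc _ (y ^ d)⁻¹, inv_mul_cancel_left₀ hyd0, mul_assoc, h2, mul_assoc]
    have h3 := congrArg (Ideal.Quotient.mk (maxIdeal (⊤ : Subalgebra K B))) h1
    rw [map_mul, map_mul, (Finite.isDomain_to_isField _).mul_comm (Ideal.Quotient.mk _ u')] at h3
    exact mul_right_cancel₀ (fun h => (residue_eq_zero_iff.1 h).ne hu) h3
  have hcard := natCard_le_pow_of_iterate_fixed (residueMap bot_le) (conjResidue y hy0)
    (conjResidue_residueMap_bot y hy0) hfix (residueMap (le_top : L ≤ ⊤))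
    (residueMap_injective _) hd hfixL
  rw [natCard_residueField (bot_le : ⊥ ≤ L)] at hcard
  exact (Nat.pow_le_pow_iff_right (one_lt_natCard_residueField _)).1 hcard

end Comparison

end LocalDivisionAlgebra

/-! ### The final count. -/

open LocalDivisionAlgebra

theorem mainTheorem7 {K : Type*} [NontriviallyNormedField K] [IsUltrametricDist K]
    [LocallyCompactSpace K] {B : Type*} [DivisionRing B] [Algebra K B] [FiniteDimensional K B]
    [Algebra.IsCentral K B] (L C : Subalgebra K B)
    (hC : C = Subalgebra.centralizer K (L : Set B)) :
    LocalDivisionAlgebra.ramificationIndex (bot_le : ⊥ ≤ L) =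
        LocalDivisionAlgebra.residualDegree (le_top : C ≤ ⊤) ∧
      (LocalDivisionAlgebra.residualDegree (bot_le : ⊥ ≤ L) : ℝ) =
        LocalDivisionAlgebra.ramificationIndex (le_top : C ≤ ⊤) := by
  have hcomm : ∀ x ∈ C, ∀ l ∈ L, Commute x l := fun x hx l hl => by
    rw [hC, Subalgebra.mem_centralizer_iff] at hx
    exact (hx l hl).symm
  obtain ⟨eL, heL0, heL, heL'⟩ := exists_ramificationIndex_eq (bot_le : ⊥ ≤ L)
  obtain ⟨eC, heC0, heC, -⟩ := exists_ramificationIndex_eq (bot_le : ⊥ ≤ C)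
  obtain ⟨dL, hdL0, hdL, -⟩ := exists_ramificationIndex_eq (le_top : L ≤ ⊤)
  obtain ⟨dC, hdC0, hdC, hdC'⟩ := exists_ramificationIndex_eq (le_top : C ≤ ⊤)
  obtain ⟨n, hn0, hn, -⟩ := exists_ramificationIndex_eq (bot_le : ⊥ ≤ (⊤ : Subalgebra K B))
  have hinj : Function.Injective fun k : ℕ => unifVal (⊤ : Subalgebra K B) ^ k :=
    pow_right_injective₀ (unifVal_pos _) (unifVal_lt_one _).ne
  have hnL : n = dL * eL := hinj (by
    change unifVal _ ^ n = unifVal _ ^ (dL * eL)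
    rw [pow_mul, ← hdL, ← heL, hn])
  have hnC : n = dC * eC := hinj (by
    change unifVal _ ^ n = unifVal _ ^ (dC * eC)
    rw [pow_mul, ← hdC, ← heC, hn])
  have hfL := residualDegree_le_of_commute hcomm hdC0 hdC
  have hfC := residualDegree_le_of_commute (fun l hl x hx => (hcomm x hx l hl).symm) hdL0 hdL
  have hfB : residualDegree (bot_le : ⊥ ≤ (⊤ : Subalgebra K B)) = n := by
    -- Scalars commute with all of `B`, so the commuting-pair bound applies to the pair (`B`, `K`).
    refine le_antisymm (residualDegree_le_of_commute (L := ⊤) (C := ⊥) (fun x hx l _ => ?_) hn0 hn)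
      (ramification_le_residualDegree hn)
    obtain ⟨c, rfl⟩ := Algebra.mem_bot.1 hx
    exact Algebra.commutes c l
  have htower := residualDegree_mul (bot_le : ⊥ ≤ C) le_top
  have hB := mul_residualDegree_le_finrank hn
  have hdim := finrank_le_finrank_mul_finrank_centralizer L
  rw [← hC] at hdim
  have hL := finrank_le_mul_residualDegree L heL0 heL
  have hCf := finrank_le_mul_residualDegree C heC0 heC
  rw [hfB] at htower hB
  have hfC0 := residualDegree_pos (bot_le : ⊥ ≤ C)
  rw [heL', hdC']
  generalize residualDegree (bot_le : ⊥ ≤ L) = fL at *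
  generalize residualDegree (bot_le : ⊥ ≤ C) = fC at *
  generalize residualDegree (le_top : C ≤ ⊤) = fBC at *
  -- Writing n² as (dL eL)(dC eC) makes the factor eL eC cancel from the dimension estimate.
  have hprod : eL * eC * (dL * dC) ≤ eL * eC * (fL * fC) :=
    calc eL * eC * (dL * dC) = n * n := by
          nth_rw 1 [hnL]
          rw [hnC]
          ring
      _ ≤ (eL * fL) * (eC * fC) := hB.trans (hdim.trans (Nat.mul_le_mul hL hCf))
      _ = eL * eC * (fL * fC) := by ring
  have hle : dL * dC ≤ fL * fC := Nat.le_of_mul_le_mul_left hprod (Nat.mul_pos heL0 heC0)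
  have h1 : fC = dL := by
    refine le_antisymm hfC (Nat.le_of_mul_le_mul_right (hle.trans ?_) hdC0)
    rw [mul_comm]
    exact Nat.mul_le_mul_left _ hfL
  have h2 : fL = dC := by
    refine le_antisymm hfL (Nat.le_of_mul_le_mul_left (hle.trans ?_) hdL0)
    rw [mul_comm]
    exact Nat.mul_le_mul_right _ hfC
  refine ⟨?_, by rw [h2]⟩
  -- Both fC · fBC and dL · eL equal `n`, and fC = dL.
  have h3 : eL = fBC := by
    refine Nat.eq_of_mul_eq_mul_left hfC0 ?_
    rw [htower, h1, hnL]
  rw [h3]
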